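/- **Setting.** Let $\Omega\subset[0,\infty)$ be finite, $\mathcal H_\Omega$ the Hilbert space with orthonormal basis $(|x\rangle)_{x\in\Omega}$, and $\mathcal H_g$ a complex Hilbert space; fix unit initial states $|0\rangle$ of both. A *quantum sampler* for a probability distribution $d$ on $\Omega$ is a unitary $\mathcal S$ on $\mathcal H_g\otimes\mathcal H_\Omega$ with $\mathcal S|0\rangle|0\rangle=\sum_{x\in\Omega}\sqrt{d(x)}\,|\psi_x\rangle|x\rangle$ for some unit vectors $|\psi_x\rangle$. Its output $v(\mathcal S)$ is the result of measuring the $x$-register of $\mathcal S|0\rangle|0\rangle$, so it has distribution $d$; write $\mu_{\mathcal S}=\mathbb E[v(\mathcal S)]$ and $\phi_{\mathcal S}=\sqrt{\mathbb E[v(\mathcal S)^2]}$. A *quantum sample* is one (possibly controlled) execution of $\mathcal S$ or $\mathcal S^{-1}$. All logarithms are in base 2. **Algorithms.** *Amplitude estimation* $\mathrm{AmpEst}(U,\Pi,t)$, for a unitary $U$, a projector $\Pi$ and an integer $t\ge 1$: with $Q=U(2|0\rangle\langle 0|-I)U^{-1}(I-2\Pi)$, prepare $t^{-1/2}\sum_{j<t}|j\rangle\,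 Q^jU|0\rangle$ by a Fourier transform over $\mathbb Z/t$, an application of $U$ and $t-1$ controlled applications of $Q$; apply the inverse Fourier transform to the first register, measure it, and output $\sin^2(\pi y/t)$ for the result $y$. *Basic estimation* $\mathrm{BasicEst}(\mathcal S,(a,b),t,\delta)$: let $R_{a,b}$ be the rotation of an additional qubit with $R_{a,b}|x\rangle|0\rangle=|x\rangle\bigl(\sqrt{1-x/b}\,|0\rangle+\sqrt{x/b}\,|1\rangle\bigr)$ if $a\le x<b$ and $R_{a,b}|x\rangle|0\rangle=|x\rangle|0\rangle$ otherwise. Output the median of $2\lceil 4\log(1/\delta)\rceil+1$ independent runs of $\mathrm{AmpEst}(U,\Pi,t)$ with $U=(I\otimes R_{a,b})(\mathcal S\otimes I)$ and $\Pi=I\otimes|1\rangle\langle1|$. *Subroutine* $\mathrm{SApprox}(\mathcal S,w,t,\delta)$: let $k=\lceil\log t\rceil-1$ and $t_0=\lceil3\pi^2t\sqrt{\log t}\rceil$. Compute $\tilde p_0=\mathrm{BasicEst}(\mathcal S,(0,w),t_0,\delta/(k+1))$ and $\tilde p_\ell=\mathrm{BasicEst}(\mathcal S,(2^{\ell-1}w,2^\ell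 w),t_0,\delta/(k+1))$ for $1\le\ell\le k$, and output $\sum_{\ell=0}^k2^\ell w\,\tilde p_\ell$. *Algorithm* $\mathrm{EpsApprox}(\mathcal S,\Delta,L,H,\varepsilon,\delta)$, for an integer $\Delta\ge1$ and reals $0<L<H$, $0<\varepsilon,\delta<1/2$: 1. Set $M=8H$ and $\tilde p=0$. 2. While $\tilde p=0$ and $M\ge2L$: replace $M$ by $M/2$, then set $\tilde p=\mathrm{BasicEst}(\mathcal S,(0,M\Delta^2),25\Delta,\delta')$ where $\delta'=\delta/(2(3+\log(H/L)))$. 3. If $M<2L$, output $0$. 4. Otherwise output the result of $\mathrm{SApprox}(\mathcal S,M\Delta,51^2\varepsilon^{-1}\Delta,\delta/2)$. **Theorem (Quantum Chebyshev inequality).** Let $\Delta\ge1$ be an integer, $0<L<H$ and $0<\varepsilon,\delta<1/2$, and let $\tilde\mu_{\mathcal S}$ be the output of $\mathrm{EpsApprox}(\mathcal S,\Delta,L,H,\varepsilon,\delta)$. 1. If $\Delta\ge\phi_{\mathcal S}/\mu_{\mathcal S}$ and $L<\mu_{\mathcal S}<H$, then $|\tilde\mu_{\mathcal S}-\mu_{\mathcal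 S}|\le\varepsilon\mu_{\mathcal S}$ with probability at least $1-\delta$. 2. For any $\Delta,L,H$ as above, $\tilde\mu_{\mathcal S}\le(1+2\pi)^2\mu_{\mathcal S}$ with probability at least $1-\delta$. 3. There is an absolute constant $C$ such that, for all valid inputs, every execution of the algorithm uses at most $$C\,\Delta\left(\log\tfrac{2H}{L}\,\log\tfrac{\log(2H/L)}{\delta}+\varepsilon^{-1}\log^{3/2}\!\left(\tfrac{\Delta}{\varepsilon}\right)\log\tfrac{\log(\Delta/\varepsilon)}{\delta}\right)$$ quantum samples. In particular, for every $c>0$ there is a constant $C_c$ such that, whenever $\Delta\ge2$, $H\ge2L$ and $\varepsilon^{-1}\le\Delta^c$, every execution uses at most $$C_c\,\Delta\left(\log\tfrac HL\,\log\tfrac{\log(H/L)}{\delta}+\varepsilon^{-1}\log^{3/2}(\Delta)\,\log\tfrac{\log\Delta}{\delta}\right)$$ quantum samples. -/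

import Mathlib

universe u

namespace QCheb

/-! ## Registers

`Reg A K` is the Hilbert space `ℂ^A ⊗ K`, for a finite set `A` of computational basis states: a
vector is written `∑ a, |a⟩ ⊗ v a`, and its norm is `(∑ a, ‖v a‖ ^ 2) ^ (1 / 2)`. -/

abbrev Reg (A : Type) [Fintype A] (K : Type u) [NormedAddCommGroup K] : Type u :=
  PiLp 2 (fun _ : A => K)

section Unitaries

variable {A B T : Type} [Fintype A] [Fintype B] [Fintype T]
variable {K : Type u} [NormedAddCommGroup K]

lemma reg_norm_sq (v : Reg A K) : ‖v‖ ^ 2 = ∑ a, ‖v a‖ ^ 2 :=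
  PiLp.norm_sq_eq_of_L2 _ v

variable [InnerProductSpace ℂ K]

/-- The identification `ℂ^(T × B) ⊗ K = ℂ^T ⊗ (ℂ^B ⊗ K)`. -/
noncomputable def curryReg : Reg (T × B) K ≃ₗᵢ[ℂ] Reg T (Reg B K) where
  toFun v := WithLp.toLp 2 fun τ => WithLp.toLp 2 fun b => v (τ, b)
  invFun w := WithLp.toLp 2 fun i => w i.1 i.2
  map_add' _ _ := rfl
  map_smul' _ _ := rfl
  left_inv _ := rfl
  right_inv _ := rfl
  norm_map' v := by
    have h : ‖(WithLp.toLp 2 fun τ => WithLp.toLp 2 fun b => v (τ, b) : Reg T (Reg B K))‖ ^ 2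
        = ‖v‖ ^ 2 := by
      rw [reg_norm_sq, reg_norm_sq, Fintype.sum_prod_type]
      exact Finset.sum_congr rfl fun τ _ => reg_norm_sq _
    exact (sq_eq_sq₀ (norm_nonneg _) (norm_nonneg _)).1 h

lemma mulAct_norm_sq [DecidableEq A] (M : Matrix A A ℂ) (hM : M.conjTranspose * M = 1)
    (v : Reg A K) :
    ∑ a, ‖∑ a', M a a' • v a'‖ ^ 2 = ∑ a, ‖v a‖ ^ 2 := by
  have key : ∀ i j, ∑ a, (starRingEnd ℂ) (M a i) * M a j = if i = j then 1 else 0 := by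
    intro i j
    have := congrFun (congrFun hM i) j
    simpa [Matrix.mul_apply, Matrix.one_apply] using this
  have h : ((∑ a, ‖∑ a', M a a' • v a'‖ ^ 2 : ℝ) : ℂ) = ((∑ a, ‖v a‖ ^ 2 : ℝ) : ℂ) := by
    push_cast
    calc ∑ a, ((‖∑ a', M a a' • v a'‖ : ℂ)) ^ 2
        = ∑ a, ∑ i, ∑ j, ((starRingEnd ℂ) (M a i) * M a j) * inner ℂ (v i) (v j) := by
          refine Finset.sum_congr rfl fun a _ => ?_
          have h1 := inner_self_eq_norm_sq_to_K (𝕜 := ℂ) (∑ a', M a a' • v a')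
          rw [sum_inner] at h1
          simp only [inner_sum, inner_smul_left, inner_smul_right] at h1
          refine Eq.trans h1.symm ?_
          refine Finset.sum_congr rfl fun i _ => Finset.sum_congr rfl fun j _ => ?_
          ring
      _ = ∑ i, ∑ j, (∑ a, (starRingEnd ℂ) (M a i) * M a j) * inner ℂ (v i) (v j) := by
          rw [Finset.sum_comm]
          refine Finset.sum_congr rfl fun i _ => ?_
          rw [Finset.sum_comm]
          refine Finset.sum_congr rfl fun j _ => ?_
          rw [Finset.sum_mul]
      _ = ∑ i, ((‖v i‖ : ℂ)) ^ 2 := by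
          refine Finset.sum_congr rfl fun i _ => ?_
          simp only [key, ite_mul, one_mul, zero_mul, Finset.sum_ite_eq, Finset.mem_univ, if_true]
          exact inner_self_eq_norm_sq_to_K (𝕜 := ℂ) (v i)
  exact_mod_cast h

/-- The action `M ⊗ I` of a unitary matrix on the first factor of `ℂ^A ⊗ K`. -/
noncomputable def matrixGate [DecidableEq A] (M : Matrix.unitaryGroup A ℂ) :
    Reg A K ≃ₗᵢ[ℂ] Reg A K where
  toFun v := WithLp.toLp 2 fun a => ∑ a', (M : Matrix A A ℂ) a a' • v a'
  invFun v := WithLp.toLp 2 fun a => ∑ a', (M : Matrix A A ℂ).conjTranspose a a' • v a'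
  map_add' v w := by
    ext a
    simp [smul_add, Finset.sum_add_distrib]
  map_smul' c v := by
    ext a
    simp [Finset.smul_sum, smul_comm c]
  left_inv v := by
    have h : (M : Matrix A A ℂ).conjTranspose * (M : Matrix A A ℂ) = 1 :=
      Matrix.mem_unitaryGroup_iff'.1 M.2
    ext a
    simp only [Finset.smul_sum, smul_smul]
    rw [Finset.sum_comm]
    simp only [← Finset.sum_smul, ← Matrix.mul_apply, h, Matrix.one_apply]
    simp
  right_inv v := by
    have h : (M : Matrix A A ℂ) * (M : Matrix A A ℂ).conjTranspose = 1 :=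
      Matrix.mem_unitaryGroup_iff.1 M.2
    ext a
    simp only [Finset.smul_sum, smul_smul]
    rw [Finset.sum_comm]
    simp only [← Finset.sum_smul, ← Matrix.mul_apply, h, Matrix.one_apply]
    simp
  norm_map' v := by
    have h : ‖(WithLp.toLp 2 fun a => ∑ a', (M : Matrix A A ℂ) a a' • v a' : Reg A K)‖ ^ 2
        = ‖v‖ ^ 2 := by
      rw [reg_norm_sq, reg_norm_sq]
      exact mulAct_norm_sq _ (Matrix.mem_unitaryGroup_iff'.1 M.2) v
    exact (sq_eq_sq₀ (norm_nonneg _) (norm_nonneg _)).1 h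

/-- The matrix `t^(-1/2) * exp (2 * π * i * j * k / t)` of the quantum Fourier transform. -/
noncomputable def fourierMatrix (t : ℕ) : Matrix (Fin t) (Fin t) ℂ :=
  Matrix.of fun k j =>
    ((Real.sqrt t : ℝ) : ℂ)⁻¹ * Complex.exp (2 * Real.pi * Complex.I / t) ^ ((k : ℕ) * (j : ℕ))

lemma fourierMatrix_mem (t : ℕ) : fourierMatrix t ∈ Matrix.unitaryGroup (Fin t) ℂ := by
  rw [Matrix.mem_unitaryGroup_iff']
  ext i j
  have ht : t ≠ 0 := fun h => by subst h; exact i.elim0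
  set ζ : ℂ := Complex.exp (2 * Real.pi * Complex.I / t) with hζ
  have hprim : IsPrimitiveRoot ζ t := Complex.isPrimitiveRoot_exp t ht
  have hζ0 : ζ ≠ 0 := Complex.exp_ne_zero _
  have hnorm : ‖ζ‖ = 1 := hprim.norm'_eq_one ht
  have hconj : (starRingEnd ℂ) ζ = ζ⁻¹ := (Complex.inv_eq_conj hnorm).symm
  have hs : ((Real.sqrt t : ℝ) : ℂ)⁻¹ * ((Real.sqrt t : ℝ) : ℂ)⁻¹ = (t : ℂ)⁻¹ := by
    rw [← mul_inv, ← Complex.ofReal_mul, Real.mul_self_sqrt (Nat.cast_nonneg t)]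
    simp
  have hterm : ∀ k : Fin t, star (fourierMatrix t k i) * fourierMatrix t k j
      = (t : ℂ)⁻¹ * (ζ⁻¹ ^ (i : ℕ) * ζ ^ (j : ℕ)) ^ (k : ℕ) := by
    intro k
    simp only [fourierMatrix, Matrix.of_apply, ← hζ, RCLike.star_def, map_mul, map_inv₀,
      Complex.conj_ofReal, map_pow, hconj]
    rw [← hs, mul_pow, ← pow_mul, ← pow_mul, mul_comm (i : ℕ), mul_comm (j : ℕ)]
    ring
  have hsum : ((star (fourierMatrix t)) * fourierMatrix t) i j
      = (t : ℂ)⁻¹ * ∑ k ∈ Finset.range t, (ζ⁻¹ ^ (i : ℕ) * ζ ^ (j : ℕ)) ^ k := by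
    rw [Matrix.mul_apply, Finset.mul_sum,
      ← Fin.sum_univ_eq_sum_range (fun k => (t : ℂ)⁻¹ * (ζ⁻¹ ^ (i : ℕ) * ζ ^ (j : ℕ)) ^ k)]
    exact Finset.sum_congr rfl fun k _ => by rw [← hterm k]; rfl
  rw [hsum, Matrix.one_apply]
  split_ifs with hij
  · subst hij
    have : ζ⁻¹ ^ (i : ℕ) * ζ ^ (i : ℕ) = 1 := by
      rw [← mul_pow, inv_mul_cancel₀ hζ0, one_pow]
    simp only [this, one_pow]
    simp [ht]
  · have hne : ζ⁻¹ ^ (i : ℕ) * ζ ^ (j : ℕ) ≠ 1 := by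
      intro h
      apply hij
      rw [inv_pow, inv_mul_eq_one₀ (pow_ne_zero _ hζ0)] at h
      exact Fin.ext (hprim.pow_inj i.2 j.2 h)
    have hpow : (ζ⁻¹ ^ (i : ℕ) * ζ ^ (j : ℕ)) ^ t = 1 := by
      rw [mul_pow, ← pow_mul, ← pow_mul, mul_comm (i : ℕ), mul_comm (j : ℕ), pow_mul, pow_mul,
        inv_pow, hprim.pow_eq_one]
      simp
    have hg := geom_sum_mul (ζ⁻¹ ^ (i : ℕ) * ζ ^ (j : ℕ)) t
    rw [hpow, sub_self] at hg
    rw [(mul_eq_zero.1 hg).resolve_right (sub_ne_zero.2 hne), mul_zero]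

/-- The quantum Fourier transform on the first factor of `ℂ^t ⊗ K`. -/
noncomputable def fourier (t : ℕ) : Reg (Fin t) K ≃ₗᵢ[ℂ] Reg (Fin t) K :=
  matrixGate ⟨fourierMatrix t, fourierMatrix_mem t⟩

/-- The unitary `V` applied to the second factor of `ℂ^T ⊗ K`, controlled on the first factor being
in a basis state `|τ⟩` with `P τ`. -/
noncomputable def controlled (P : T → Bool) (V : K ≃ₗᵢ[ℂ] K) : Reg T K ≃ₗᵢ[ℂ] Reg T K :=
  LinearIsometryEquiv.piLpCongrRight 2 fun τ => if P τ then V else LinearIsometryEquiv.refl ℂ K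

/-- The reflection `I - 2Π` with `Π = |1⟩⟨1| ⊗ I` on `ℂ² ⊗ K`. -/
noncomputable def flagReflection : Reg (Fin 2) K ≃ₗᵢ[ℂ] Reg (Fin 2) K :=
  controlled (fun q => q == 1) (LinearIsometryEquiv.neg ℂ)

/-- The reflection `2|v⟩⟨v| - I`. -/
noncomputable def ketReflection (v : K) : K ≃ₗᵢ[ℂ] K :=
  (Submodule.span ℂ {v}).reflection

lemma rotation_norm_sq (c s : ℝ) (h : c ^ 2 + s ^ 2 = 1) (x y : K) :
    ‖(c : ℂ) • x - (s : ℂ) • y‖ ^ 2 + ‖(s : ℂ) • x + (c : ℂ) • y‖ ^ 2 = ‖x‖ ^ 2 + ‖y‖ ^ 2 := by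
  rw [@norm_sub_sq ℂ, @norm_add_sq ℂ]
  simp only [norm_smul, inner_smul_left, inner_smul_right, Complex.conj_ofReal,
    Complex.norm_real, mul_pow, Real.norm_eq_abs, sq_abs]
  have e : (c : ℂ) * ((s : ℂ) * inner ℂ x y) = (s : ℂ) * ((c : ℂ) * inner ℂ x y) := by ring
  simp only [e]
  linear_combination (‖x‖ ^ 2 + ‖y‖ ^ 2) * h

/-- The rotation of a qubit, controlled by a basis state `|a⟩` of `A`:
`|0⟩|a⟩ ↦ (c a |0⟩ + s a |1⟩)|a⟩` and `|1⟩|a⟩ ↦ (-s a |0⟩ + c a |1⟩)|a⟩`. -/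
noncomputable def rotation (c s : A → ℝ) (h : ∀ a, c a ^ 2 + s a ^ 2 = 1) :
    Reg (Fin 2) (Reg A K) ≃ₗᵢ[ℂ] Reg (Fin 2) (Reg A K) where
  toFun v := WithLp.toLp 2
    ![WithLp.toLp 2 fun a => (c a : ℂ) • v 0 a - (s a : ℂ) • v 1 a,
      WithLp.toLp 2 fun a => (s a : ℂ) • v 0 a + (c a : ℂ) • v 1 a]
  invFun v := WithLp.toLp 2
    ![WithLp.toLp 2 fun a => (c a : ℂ) • v 0 a + (s a : ℂ) • v 1 a,
      WithLp.toLp 2 fun a => (c a : ℂ) • v 1 a - (s a : ℂ) • v 0 a]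
  map_add' v w := by
    ext q a
    fin_cases q <;> simp <;> module
  map_smul' r v := by
    ext q a
    fin_cases q <;> simp <;> module
  left_inv v := by
    ext q a
    have h' : (c a : ℂ) ^ 2 + (s a : ℂ) ^ 2 = 1 := by exact_mod_cast h a
    fin_cases q
    · have : (c a : ℂ) • ((c a : ℂ) • v 0 a - (s a : ℂ) • v 1 a)
          + (s a : ℂ) • ((s a : ℂ) • v 0 a + (c a : ℂ) • v 1 a)
          = ((c a : ℂ) ^ 2 + (s a : ℂ) ^ 2) • v 0 a := by module
      simpa [h'] using this
    · have : (c a : ℂ) • ((s a : ℂ) • v 0 a + (c a : ℂ) • v 1 a)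
          - (s a : ℂ) • ((c a : ℂ) • v 0 a - (s a : ℂ) • v 1 a)
          = ((c a : ℂ) ^ 2 + (s a : ℂ) ^ 2) • v 1 a := by module
      simpa [h'] using this
  right_inv v := by
    ext q a
    have h' : (c a : ℂ) ^ 2 + (s a : ℂ) ^ 2 = 1 := by exact_mod_cast h a
    fin_cases q
    · have : (c a : ℂ) • ((c a : ℂ) • v 0 a + (s a : ℂ) • v 1 a)
          - (s a : ℂ) • ((c a : ℂ) • v 1 a - (s a : ℂ) • v 0 a)
          = ((c a : ℂ) ^ 2 + (s a : ℂ) ^ 2) • v 0 a := by module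
      simpa [h'] using this
    · have : (s a : ℂ) • ((c a : ℂ) • v 0 a + (s a : ℂ) • v 1 a)
          + (c a : ℂ) • ((c a : ℂ) • v 1 a - (s a : ℂ) • v 0 a)
          = ((c a : ℂ) ^ 2 + (s a : ℂ) ^ 2) • v 1 a := by module
      simpa [h'] using this
  norm_map' v := by
    refine (sq_eq_sq₀ (norm_nonneg _) (norm_nonneg _)).1 ?_
    rw [reg_norm_sq, reg_norm_sq, Fin.sum_univ_two, Fin.sum_univ_two, reg_norm_sq, reg_norm_sq,
      reg_norm_sq, reg_norm_sq, ← Finset.sum_add_distrib, ← Finset.sum_add_distrib]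
    exact Finset.sum_congr rfl fun a _ => rotation_norm_sq (c a) (s a) (h a) (v 0 a) (v 1 a)

end Unitaries

/-! ## Circuits and adaptive algorithms with access to a unitary `S` acting on `H`

Circuits and algorithms are syntactic objects, written down without reference to `S`; the unitary
`S` enters only when a circuit is run. -/

section Programs

variable {H : Type u} [NormedAddCommGroup H] [InnerProductSpace ℂ H]

/-- A gate on `ℂ^A ⊗ H`: a fixed unitary, or an execution of `S` or `S⁻¹` on `H`, controlled on
the ancilla being in a basis state `|a⟩` with `P a`. -/
inductive Gate (A : Type) [Fintype A] (H : Type u) [NormedAddCommGroup H]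
    [InnerProductSpace ℂ H] : Type u
  | free (V : Reg A H ≃ₗᵢ[ℂ] Reg A H)
  | sample (P : A → Bool)
  | sampleInv (P : A → Bool)

variable {A B T : Type} [Fintype A] [Fintype B] [Fintype T]

namespace Gate

noncomputable def inv : Gate A H → Gate A H
  | free V => free V.symm
  | sample P => sampleInv P
  | sampleInv P => sample P

/-- The controlled version of a gate, for a control register `ℂ^T`. -/
noncomputable def control (P : T → Bool) : Gate B H → Gate (T × B) H
  | free V => free ((curryReg.trans (controlled P V)).trans curryReg.symm)
  | sample Q => sample fun i => P i.1 && Q i.2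
  | sampleInv Q => sampleInv fun i => P i.1 && Q i.2

noncomputable def eval (S : H ≃ₗᵢ[ℂ] H) : Gate A H → (Reg A H ≃ₗᵢ[ℂ] Reg A H)
  | free V => V
  | sample P => controlled P S
  | sampleInv P => controlled P S.symm

/-- The number of quantum samples used by a gate. -/
def samples : Gate A H → ℕ
  | free _ => 0
  | sample _ => 1
  | sampleInv _ => 1

end Gate

/-- A circuit is a list of gates, the first gate of the list being applied first. -/
abbrev Circuit (A : Type) [Fintype A] (H : Type u) [NormedAddCommGroup H]
    [InnerProductSpace ℂ H] : Type u := List (Gate A H)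

namespace Circuit

noncomputable def inv (c : Circuit A H) : Circuit A H := (c.map Gate.inv).reverse

noncomputable def control (P : T → Bool) (c : Circuit B H) : Circuit (T × B) H :=
  c.map (Gate.control P)

noncomputable def eval (S : H ≃ₗᵢ[ℂ] H) (c : Circuit A H) : Reg A H ≃ₗᵢ[ℂ] Reg A H :=
  c.foldl (fun V g => V.trans (g.eval S)) (LinearIsometryEquiv.refl ℂ _)

/-- The number of quantum samples used by a circuit. -/
def samples (c : Circuit A H) : ℕ := (c.map Gate.samples).sum

end Circuit

/-- The Born rule: measuring the first factor of the unit vector `v` of `ℂ^A ⊗ H` gives `a` with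
probability `‖(⟨a| ⊗ I) v‖ ^ 2`. -/
noncomputable def measure (v : Reg A H) (hv : ‖v‖ = 1) : PMF A :=
  PMF.ofFintype (fun a => ENNReal.ofReal (‖v a‖ ^ 2)) (by
    rw [← ENNReal.ofReal_sum_of_nonneg fun a _ => sq_nonneg _, ← reg_norm_sq, hv]
    simp)

/-- An adaptive algorithm: either it stops and outputs a value, or it runs a circuit on a fixed
initial unit vector, measures the ancilla, and continues in a way that depends on the outcome. -/
inductive Prog (H : Type u) [NormedAddCommGroup H] [InnerProductSpace ℂ H] (α : Type) :
    Type (max 1 u)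
  | ret (x : α) : Prog H α
  | run (A : Type) [Fintype A] (init : Reg A H) (norm_init : ‖init‖ = 1) (c : Circuit A H)
      (next : A → Prog H α) : Prog H α

namespace Prog

variable {α β : Type}

noncomputable def bind : Prog H α → (α → Prog H β) → Prog H β
  | ret x, f => f x
  | run A init h c next, f => run A init h c fun a => (next a).bind f

noncomputable instance : Monad (Prog H) where
  pure := ret
  bind := bind

/-- Runs `n` algorithms one after the other, and returns the tuple of their outputs. -/
noncomputable def collect : (n : ℕ) → (Fin n → Prog H α) → Prog H (Fin n → α)
  | 0, _ => pure Fin.elim0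
  | n + 1, p => do
      let x ← p 0
      let xs ← collect n fun i => p i.succ
      pure (Fin.cons x xs)

/-- The distribution of the output, when the algorithm is given access to `S`. -/
noncomputable def law (S : H ≃ₗᵢ[ℂ] H) : Prog H α → PMF α
  | ret x => PMF.pure x
  | run _ init h c next =>
      (measure (c.eval S init) (by rw [LinearIsometryEquiv.norm_map, h])).bind
        fun a => (next a).law S

/-- The largest number of quantum samples used in any execution of the algorithm. -/
noncomputable def samples : Prog H α → ℕ
  | ret _ => 0
  | run _ _ _ c next => c.samples + Finset.univ.sup fun a => (next a).samples

end Prog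

end Programs

/-! ## Quantum samplers -/

/-- The registers `H_g ⊗ H_Ω` on which a sampler over `Ω` acts: a finite sample space of
non-negative reals, a Hilbert space `G = H_g`, and the initial states `|0⟩` of both factors. The
space `H_Ω` has basis `(|x⟩)` indexed by `x ∈ Ω`. -/
structure Registers (Ω : Finset ℝ) (G : Type u) [NormedAddCommGroup G] [InnerProductSpace ℂ G] where
  nonneg : ∀ x ∈ Ω, 0 ≤ x
  zeroG : G
  norm_zeroG : ‖zeroG‖ = 1
  zeroΩ : EuclideanSpace ℂ Ω
  norm_zeroΩ : ‖zeroΩ‖ = 1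

section Sampler

variable {Ω : Finset ℝ} {G : Type u} [NormedAddCommGroup G] [InnerProductSpace ℂ G]

namespace Registers

/-- The vector `|0⟩|0⟩` of `H_g ⊗ H_Ω`. -/
noncomputable def zero (R : Registers Ω G) : Reg Ω G :=
  WithLp.toLp 2 fun x => R.zeroΩ x • R.zeroG

lemma norm_zero (R : Registers Ω G) : ‖R.zero‖ = 1 := by
  refine (sq_eq_sq₀ (norm_nonneg _) zero_le_one).1 ?_
  have h := R.norm_zeroΩ
  have h2 : ‖R.zeroΩ‖ ^ 2 = ∑ x, ‖R.zeroΩ x‖ ^ 2 := reg_norm_sq R.zeroΩ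
  rw [h] at h2
  rw [reg_norm_sq, h2]
  exact Finset.sum_congr rfl fun x _ => by simp [zero, norm_smul, R.norm_zeroG]

end Registers

/-- A quantum sampler: a unitary `S` on `H_g ⊗ H_Ω` with
`S |0⟩|0⟩ = ∑ x, √(d x) |ψ x⟩|x⟩` for a probability distribution `d` on `Ω` and unit vectors
`ψ x`. -/
structure Sampler (Ω : Finset ℝ) (G : Type u) [NormedAddCommGroup G] [InnerProductSpace ℂ G]
    extends Registers Ω G where
  d : Ω → ℝ
  d_nonneg : ∀ x, 0 ≤ d x
  d_sum : ∑ x, d x = 1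
  ψ : Ω → G
  norm_ψ : ∀ x, ‖ψ x‖ = 1
  S : Reg Ω G ≃ₗᵢ[ℂ] Reg Ω G
  S_zero : S toRegisters.zero = WithLp.toLp 2 fun x => (Real.sqrt (d x) : ℂ) • ψ x

namespace Sampler

/-- Measuring the `x`-register of `S |0⟩|0⟩` gives `x` with probability `d x`. -/
lemma born_rule (s : Sampler Ω G) (x : Ω) : ‖s.S s.zero x‖ ^ 2 = s.d x := by
  rw [s.S_zero]
  simp [norm_smul, s.norm_ψ, Real.sq_sqrt (s.d_nonneg x)]

/-- The mean of the output of the sampler. -/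
noncomputable def mean (s : Sampler Ω G) : ℝ := ∑ x, s.d x * (x : ℝ)

/-- The square root of the second moment of the output of the sampler. -/
noncomputable def rms (s : Sampler Ω G) : ℝ := Real.sqrt (∑ x, s.d x * (x : ℝ) ^ 2)

end Sampler

/-- The parameter of the `(a, b)`-Bernoulli sampler on input `x`. -/
noncomputable def bernoulliParam (a b x : ℝ) : ℝ := if a ≤ x ∧ x < b then x / b else 0

lemma bernoulliParam_mem (a b x : ℝ) (hx : 0 ≤ x) :
    0 ≤ bernoulliParam a b x ∧ bernoulliParam a b x ≤ 1 := by
  unfold bernoulliParam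
  split_ifs with h
  · have hb : 0 < b := lt_of_le_of_lt hx h.2
    exact ⟨div_nonneg hx hb.le, (div_le_one hb).2 h.2.le⟩
  · exact ⟨le_rfl, zero_le_one⟩

/-- The Bernoulli sampler `R_{a,b}`, as a controlled rotation of an additional qubit:
`|x⟩|0⟩ ↦ |x⟩(√(1 - x/b)|0⟩ + √(x/b)|1⟩)` if `a ≤ x < b`, and `|x⟩|0⟩ ↦ |x⟩|0⟩` otherwise. -/
noncomputable def bernoulliSampler (R : Registers Ω G) (a b : ℝ) :
    Reg (Fin 2) (Reg Ω G) ≃ₗᵢ[ℂ] Reg (Fin 2) (Reg Ω G) :=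
  rotation (fun x : Ω => Real.sqrt (1 - bernoulliParam a b x))
    (fun x : Ω => Real.sqrt (bernoulliParam a b x))
    (fun x => by
      have h := bernoulliParam_mem a b x (R.nonneg x x.2)
      rw [Real.sq_sqrt (sub_nonneg.2 h.2), Real.sq_sqrt h.1]
      ring)

end Sampler

/-! ## Amplitude estimation -/

section AmplitudeEstimation

variable {H : Type u} [NormedAddCommGroup H] [InnerProductSpace ℂ H]
variable {B : Type} [Fintype B]

/-- The Grover iterate `U (2|v⟩⟨v| - I) U⁻¹ (I - 2Π)`, where `v` is the initial state and `W` is the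
reflection `I - 2Π`. -/
noncomputable def groverIterate (U : Circuit B H) (v : Reg B H) (W : Reg B H ≃ₗᵢ[ℂ] Reg B H) :
    Circuit B H :=
  [Gate.free W] ++ U.inv ++ [Gate.free (ketReflection v)] ++ U

/-- A unitary on the first factor of `ℂ^(T × B) ⊗ H`. -/
noncomputable def onFirst {T : Type} [Fintype T]
    (V : Reg T (Reg B H) ≃ₗᵢ[ℂ] Reg T (Reg B H)) : Gate (T × B) H :=
  Gate.free ((curryReg.trans V).trans curryReg.symm)

/-- The amplitude estimation circuit: the Fourier transform of the phase register, the circuit `U`,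
the `j`-th power of the Grover iterate when the phase register is in the state `|j⟩`, and
the inverse Fourier transform of the phase register. -/
noncomputable def amplitudeCircuit (U : Circuit B H) (v : Reg B H)
    (W : Reg B H ≃ₗᵢ[ℂ] Reg B H) (t : ℕ) : Circuit (Fin t × B) H :=
  [onFirst (T := Fin t) (fourier (K := Reg B H) t)] ++ U.control (T := Fin t) (fun _ => true)
    ++ (List.range (t - 1)).flatMap
        (fun i => (groverIterate U v W).control (T := Fin t) fun j => decide (i < (j : ℕ)))
    ++ [onFirst (T := Fin t) (fourier (K := Reg B H) t).symm]

/-- Amplitude estimation with parameter `t`: run the amplitude estimation circuit on `|0⟩ ⊗ v`,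
measure the phase register, and output `sin² (π y / t)` for the outcome `y`. -/
noncomputable def amplitudeEstimation (U : Circuit B H) (v : Reg B H) (hv : ‖v‖ = 1)
    (W : Reg B H ≃ₗᵢ[ℂ] Reg B H) (t : ℕ) : Prog H ℝ :=
  if ht : 0 < t then
    Prog.run (Fin t × B) (curryReg.symm (PiLp.single 2 (⟨0, ht⟩ : Fin t) v))
      (by rw [LinearIsometryEquiv.norm_map, PiLp.norm_single, hv])
      (amplitudeCircuit U v W t)
      (fun i => pure (Real.sin (Real.pi * (i.1 : ℕ) / t) ^ 2))
  else pure 0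

end AmplitudeEstimation

/-! ## The mean estimation algorithms -/

section Algorithms

variable {Ω : Finset ℝ} {G : Type u} [NormedAddCommGroup G] [InnerProductSpace ℂ G]

/-- The median of an odd number of reals. -/
noncomputable def median {m : ℕ} (v : Fin (2 * m + 1) → ℝ) : ℝ :=
  (v ∘ Tuple.sort v) ⟨m, by omega⟩

/-- Half the number of repetitions (rounded down) in the basic estimation algorithm. -/
noncomputable def halfReps (δ : ℝ) : ℕ := ⌈4 * Real.logb 2 (1 / δ)⌉₊

/-- The basic estimation algorithm: the median of `Θ(log (1/δ))` runs of amplitude estimation with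
`U = R_{a,b} (S ⊗ I)` and `Π = I ⊗ |1⟩⟨1|`, which estimates `E[X_{a,b}] / b`. -/
noncomputable def basicEst (R : Registers Ω G) (a b : ℝ) (t : ℕ) (δ : ℝ) :
    Prog (Reg Ω G) ℝ := do
  let ps ← Prog.collect (2 * halfReps δ + 1) fun _ =>
    amplitudeEstimation (B := Fin 2)
      [Gate.sample (fun _ => true), Gate.free (bernoulliSampler R a b)]
      (PiLp.single 2 0 R.zero) (by rw [PiLp.norm_single, R.norm_zero]) flagReflection t
  pure (median ps)

/-- The bucketing subroutine, with width parameter `w`. -/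
noncomputable def sApprox (R : Registers Ω G) (w t δ : ℝ) : Prog (Reg Ω G) ℝ := do
  let k : ℕ := ⌈Real.logb 2 t⌉₊ - 1
  let t₀ : ℕ := ⌈3 * Real.pi ^ 2 * t * Real.sqrt (Real.logb 2 t)⌉₊
  let ps ← Prog.collect (k + 1) fun l =>
    basicEst R (if (l : ℕ) = 0 then 0 else 2 ^ ((l : ℕ) - 1) * w) (2 ^ (l : ℕ) * w) t₀ (δ / (k + 1))
  pure (∑ l : Fin (k + 1), 2 ^ (l : ℕ) * w * ps l)

lemma floor_half_lt {M L : ℝ} (hL : 0 < L) (h : 2 * L ≤ M) : ⌊M / 2 / L⌋₊ < ⌊M / L⌋₊ := by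
  have h2 : 2 ≤ M / L := (le_div_iff₀ hL).2 h
  rw [Nat.lt_iff_add_one_le]
  refine Nat.le_floor ?_
  have h0 : (0 : ℝ) ≤ M / 2 / L := by rw [div_right_comm]; linarith
  have h3 := Nat.floor_le h0
  have h4 : M / 2 / L = M / L / 2 := div_right_comm M 2 L
  push_cast
  linarith

/-- The loop "while `p = 0` and `M ≥ 2L`: set `M := M / 2`, and let `p` be the result of the basic
estimation algorithm with range `(0, M Δ²)`"; it returns the final value of `M`. -/
noncomputable def searchLoop (R : Registers Ω G) (Δ : ℕ) (L : ℝ) (hL : 0 < L) (δ' : ℝ)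
    (M p : ℝ) : Prog (Reg Ω G) ℝ :=
  if h : p = 0 ∧ 2 * L ≤ M then do
    let p' ← basicEst R 0 (M / 2 * (Δ : ℝ) ^ 2) (25 * Δ) δ'
    searchLoop R Δ L hL δ' (M / 2) p'
  else pure M
termination_by ⌊M / L⌋₊
decreasing_by exact floor_half_lt hL h.2

/-- The mean estimation algorithm. -/
noncomputable def epsApprox (R : Registers Ω G) (Δ : ℕ) (L : ℝ) (hL : 0 < L) (H ε δ : ℝ) :
    Prog (Reg Ω G) ℝ := do
  let M ← searchLoop R Δ L hL (δ / (2 * (3 + Real.logb 2 (H / L)))) (8 * H) 0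
  if M < 2 * L then pure 0 else sApprox R (M * Δ) (51 ^ 2 * ε⁻¹ * Δ) (δ / 2)

end Algorithms

end QCheb

/-!
Amplitude estimation is analysed exactly. The Grover iterate rotates the plane spanned by the two
components of `U |0⟩` along the flag qubit by `2 θ`, where `sin² θ = p` is the probability of the
flag (`iterate_grover_apply`), so the measured phase follows an equal mixture of the Fejér kernels
with phases `± θ / π` (`norm_sq_sum_phase`). A Fejér kernel puts mass at least `8 / π²` on the two
grid points nearest to its phase, and on `0` alone if its phase is below `1 / (4 t)`
(`le_sum_fejer`, `le_fejer_zero`). Hence one run has error at most `2 π √p / t + π² / t²`, and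
outputs exactly `0` if `p ≤ 1 / (2 t)²`; the median of the repeated runs keeps both properties with
failure probability `δ` (`prob_basicEst_error_le`, `prob_basicEst_ne_zero_le`). Together they give
`p̃ ≤ (1 + 2 π)² p` unconditionally, and summing over the buckets yields the upper bound on the
output for all inputs (`prob_sApprox_gt_le`).

If `φ ≤ Δ μ`, the search continues with high probability while `M ≥ 2500 μ`, where the estimated
quantity is at most `μ / (M Δ²)`, and stops at the latest when `2 μ ≤ M < 4 μ`, where the values
above `M Δ²` contribute at most half of the mean (`prob_searchLoop_le`). In the bucketing subroutine
with `w = M Δ`, every value `x` in the `l`-th bucket, `l ≥ 1`, is within a factor `2` of `2 ^ l w`,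
so by the Cauchy-Schwarz inequality the errors sum up to `O(√(log t) (√(w μ) + φ) / t₀)`, up to a
lower order term; the values above the last bucket contribute at most `φ² / (2 ^ k w)`. The total is
smaller than `ε μ` (`bucketing_error_le`).

The number of quantum samples is bounded by structural recursion: `2 t` for a run of amplitude
estimation, times the number of repetitions, of buckets and of iterations of the search
(`samples_epsApprox_bound`).
-/

namespace QCheb

/-! ### Evaluation of circuits -/

section Circuits

variable {A B T : Type} [Fintype A] [Fintype B] [Fintype T]
variable {H : Type u} [NormedAddCommGroup H] [InnerProductSpace ℂ H]

lemma Circuit.eval_nil (S : H ≃ₗᵢ[ℂ] H) (v : Reg A H) :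
    Circuit.eval S ([] : Circuit A H) v = v := rfl

lemma Circuit.foldl_eval_apply (S : H ≃ₗᵢ[ℂ] H) (c : Circuit A H)
    (V : Reg A H ≃ₗᵢ[ℂ] Reg A H) (v : Reg A H) :
    c.foldl (fun V g => V.trans (g.eval S)) V v = Circuit.eval S c (V v) := by
  induction c generalizing V v with
  | nil => rfl
  | cons g c ih =>
    simp only [Circuit.eval, List.foldl_cons]
    rw [ih, ih]
    rfl

lemma Circuit.eval_cons (S : H ≃ₗᵢ[ℂ] H) (g : Gate A H) (c : Circuit A H) (v : Reg A H) :
    Circuit.eval S (g :: c : List (Gate A H)) v = Circuit.eval S c (g.eval S v) :=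
  Circuit.foldl_eval_apply S c _ v

lemma Circuit.eval_append (S : H ≃ₗᵢ[ℂ] H) (c c' : Circuit A H) (v : Reg A H) :
    Circuit.eval S (c ++ c' : List (Gate A H)) v = Circuit.eval S c' (Circuit.eval S c v) := by
  induction c generalizing v with
  | nil => rfl
  | cons g c ih => rw [List.cons_append, Circuit.eval_cons, ih, Circuit.eval_cons]

lemma controlled_apply (P : T → Bool) (V : H ≃ₗᵢ[ℂ] H) (v : Reg T H) (τ : T) :
    controlled P V v τ = if P τ then V (v τ) else v τ := by
  simp only [controlled, LinearIsometryEquiv.piLpCongrRight_apply]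
  split_ifs <;> rfl

lemma Gate.eval_inv_eval (S : H ≃ₗᵢ[ℂ] H) (g : Gate A H) (v : Reg A H) :
    g.inv.eval S (g.eval S v) = v := by
  cases g with
  | free V => exact V.symm_apply_apply v
  | sample P | sampleInv P =>
    ext a
    simp only [Gate.inv, Gate.eval, controlled_apply]
    split_ifs <;> simp

lemma Circuit.eval_inv_eval (S : H ≃ₗᵢ[ℂ] H) (c : Circuit A H) (v : Reg A H) :
    Circuit.eval S c.inv (Circuit.eval S c v) = v := by
  induction c generalizing v with
  | nil => rfl
  | cons g c ih =>
    have h : Circuit.inv (g :: c : List (Gate A H)) = (Circuit.inv c ++ [g.inv] : List _) := by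
      simp [Circuit.inv]
    rw [h, Circuit.eval_append, Circuit.eval_cons S g c, ih, Circuit.eval_cons, Circuit.eval_nil,
      Gate.eval_inv_eval]

lemma Circuit.eval_inv (S : H ≃ₗᵢ[ℂ] H) (c : Circuit A H) (v : Reg A H) :
    Circuit.eval S c.inv v = (Circuit.eval S c).symm v := by
  conv_lhs => rw [← (Circuit.eval S c).apply_symm_apply v]
  exact Circuit.eval_inv_eval S c _

lemma curryReg_apply (v : Reg (T × B) H) (τ : T) (b : B) : curryReg v τ b = v (τ, b) := rfl

lemma Gate.curryReg_eval_control (S : H ≃ₗᵢ[ℂ] H) (P : T → Bool) (g : Gate B H)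
    (v : Reg (T × B) H) (τ : T) :
    curryReg ((g.control P).eval S v) τ
      = if P τ then g.eval S (curryReg v τ) else curryReg v τ := by
  cases g with
  | free V =>
    simp only [Gate.control, Gate.eval, LinearIsometryEquiv.trans_apply,
      LinearIsometryEquiv.apply_symm_apply, controlled_apply]
  | sample Q | sampleInv Q =>
    ext b
    simp only [Gate.control, Gate.eval, curryReg_apply, controlled_apply]
    by_cases h : P τ <;> simp [h, controlled_apply, curryReg_apply]

lemma Circuit.curryReg_eval_control (S : H ≃ₗᵢ[ℂ] H) (P : T → Bool) (c : Circuit B H)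
    (v : Reg (T × B) H) (τ : T) :
    curryReg (Circuit.eval S (c.control P) v) τ
      = if P τ then Circuit.eval S c (curryReg v τ) else curryReg v τ := by
  induction c generalizing v with
  | nil => exact (ite_self _).symm
  | cons g c ih =>
    have h : Circuit.control P (g :: c : List (Gate B H))
        = (g.control P :: Circuit.control P c : List _) := rfl
    rw [h, Circuit.eval_cons, ih, Gate.curryReg_eval_control, Circuit.eval_cons]
    split_ifs <;> rfl

lemma curryReg_eval_onFirst (S : H ≃ₗᵢ[ℂ] H) (V : Reg T (Reg B H) ≃ₗᵢ[ℂ] Reg T (Reg B H))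
    (v : Reg (T × B) H) :
    curryReg ((onFirst V).eval S v) = V (curryReg v) := by
  simp only [onFirst, Gate.eval, LinearIsometryEquiv.trans_apply,
      LinearIsometryEquiv.apply_symm_apply]

/-- The cascade of controlled gates applies, when the phase register is in the state `|j⟩`, the
`j`-th power of the controlled circuit. -/
lemma curryReg_eval_powers (S : H ≃ₗᵢ[ℂ] H) {t : ℕ} (c : Circuit B H) (n : ℕ)
    (v : Reg (Fin t × B) H) (j : Fin t) :
    curryReg (Circuit.eval S ((List.range n).flatMap
        (fun i => c.control (T := Fin t) fun j => decide (i < (j : ℕ)))) v) j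
      = (Circuit.eval S c)^[min n j] (curryReg v j) := by
  induction n with
  | zero => simp [Circuit.eval_nil]
  | succ n ih =>
    rw [List.range_succ, List.flatMap_append, Circuit.eval_append, List.flatMap_singleton,
      Circuit.curryReg_eval_control, ih]
    by_cases h : n < (j : ℕ)
    · rw [if_pos (by simpa using h), min_eq_left h.le, min_eq_left (by omega : n + 1 ≤ j),
        Function.iterate_succ_apply']
    · rw [if_neg (by simpa using h), min_eq_right (by omega : (j : ℕ) ≤ n),
        min_eq_right (by omega : (j : ℕ) ≤ n + 1)]

lemma fourier_symm_apply {t : ℕ} (v : Reg (Fin t) H) (y : Fin t) :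
    (fourier t).symm v y = ∑ j, (starRingEnd ℂ) (fourierMatrix t j y) • v j := rfl

lemma fourier_single {t : ℕ} (ht : 0 < t) (v : H) (j : Fin t) :
    fourier t (PiLp.single 2 (⟨0, ht⟩ : Fin t) v) j = ((Real.sqrt t : ℝ) : ℂ)⁻¹ • v := by
  have h : fourier t (PiLp.single 2 (⟨0, ht⟩ : Fin t) v) j
      = ∑ k, fourierMatrix t j k • (PiLp.single 2 (⟨0, ht⟩ : Fin t) v : Reg (Fin t) H) k := rfl
  rw [h, Finset.sum_eq_single (⟨0, ht⟩ : Fin t)]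
  · simp [fourierMatrix]
  · intro k _ hk
    simp [hk]
  · simp

/-- The component `(⟨y| ⊗ I)` of the final state of amplitude estimation. -/
lemma curryReg_eval_amplitudeCircuit (S : H ≃ₗᵢ[ℂ] H) (U : Circuit B H) (v : Reg B H)
    (W : Reg B H ≃ₗᵢ[ℂ] Reg B H) {t : ℕ} (ht : 0 < t) (y : Fin t) :
    curryReg (Circuit.eval S (amplitudeCircuit U v W t)
        (curryReg.symm (PiLp.single 2 (⟨0, ht⟩ : Fin t) v))) y
      = ∑ j : Fin t, ((starRingEnd ℂ) (fourierMatrix t j y) * ((Real.sqrt t : ℝ) : ℂ)⁻¹) •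
          (Circuit.eval S (groverIterate U v W))^[j] (Circuit.eval S U v) := by
  have hsmul : ∀ (n : ℕ) (c : ℂ) (x : Reg B H), (Circuit.eval S (groverIterate U v W))^[n] (c • x)
      = c • (Circuit.eval S (groverIterate U v W))^[n] x := by
    intro n c x
    induction n with
    | zero => rfl
    | succ n ih => rw [Function.iterate_succ_apply', ih, Function.iterate_succ_apply', map_smul]
  simp only [amplitudeCircuit]
  rw [Circuit.eval_append, Circuit.eval_append, Circuit.eval_append]
  simp only [Circuit.eval_cons, Circuit.eval_nil]
  rw [curryReg_eval_onFirst, fourier_symm_apply]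
  refine Finset.sum_congr rfl fun j _ => ?_
  rw [curryReg_eval_powers, Circuit.curryReg_eval_control, if_pos rfl, curryReg_eval_onFirst,
    LinearIsometryEquiv.apply_symm_apply, fourier_single, map_smul, hsmul, smul_smul]
  congr 3
  omega

lemma eval_groverIterate (S : H ≃ₗᵢ[ℂ] H) (U : Circuit B H) (v : Reg B H) (hv : ‖v‖ = 1)
    (W : Reg B H ≃ₗᵢ[ℂ] Reg B H) (x : Reg B H) :
    Circuit.eval S (groverIterate U v W) x
      = (2 * inner ℂ (Circuit.eval S U v) (W x)) • Circuit.eval S U v - W x := by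
  simp only [groverIterate]
  rw [Circuit.eval_append, Circuit.eval_append, Circuit.eval_append, Circuit.eval_inv]
  simp only [Circuit.eval_cons, Circuit.eval_nil, Gate.eval, ketReflection]
  rw [Submodule.reflection_singleton_apply, hv, map_sub, LinearIsometryEquiv.apply_symm_apply,
    ← (Circuit.eval S U).inner_map_map, LinearIsometryEquiv.apply_symm_apply]
  simp [two_smul, two_mul, add_smul]

end Circuits

/-! ### The Dirichlet kernel -/

/-- The sum `∑_{j < t} exp (2 i j φ)`. -/
noncomputable def phaseSum (t : ℕ) (φ : ℝ) : ℂ :=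
  ∑ j ∈ Finset.range t, Complex.exp (2 * φ * Complex.I) ^ j

lemma phaseSum_add_int_mul_pi (t : ℕ) (φ : ℝ) (n : ℤ) :
    phaseSum t (φ + n * Real.pi) = phaseSum t φ := by
  have h : Complex.exp (2 * ((φ + n * Real.pi : ℝ) : ℂ) * Complex.I)
      = Complex.exp (2 * φ * Complex.I) := by
    have : 2 * ((φ + n * Real.pi : ℝ) : ℂ) * Complex.I
        = 2 * φ * Complex.I + n * (2 * Real.pi * Complex.I) := by push_cast; ring
    rw [this, Complex.exp_add, Complex.exp_int_mul_two_pi_mul_I, mul_one]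
  simp only [phaseSum, h]

lemma norm_exp_two_mul_sub_one (φ : ℝ) :
    ‖Complex.exp (2 * φ * Complex.I) - 1‖ = 2 * |Real.sin φ| := by
  have h : Complex.exp (2 * φ * Complex.I) - 1
      = 2 * Complex.I * Complex.sin φ * Complex.exp (φ * Complex.I) := by
    have e1 : Complex.exp (2 * φ * Complex.I)
        = Complex.exp (φ * Complex.I) * Complex.exp (φ * Complex.I) := by
      rw [← Complex.exp_add]; ring_nf
    have e2 : Complex.exp (-φ * Complex.I) * Complex.exp (φ * Complex.I) = 1 := by
      rw [← Complex.exp_add]; simp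
    rw [Complex.sin, e1]
    linear_combination e2 - (Complex.exp (-φ * Complex.I)
      - Complex.exp (φ * Complex.I)) * Complex.exp (φ * Complex.I) * Complex.I_sq
  rw [h, norm_mul, norm_mul, norm_mul, Complex.norm_exp_ofReal_mul_I, Complex.norm_I,
    ← Complex.ofReal_sin, Complex.norm_real, Complex.norm_ofNat, Real.norm_eq_abs]
  ring

lemma norm_phaseSum_mul_sin (t : ℕ) (φ : ℝ) :
    ‖phaseSum t φ‖ * |Real.sin φ| = |Real.sin (t * φ)| := by
  have h := geom_sum_mul (Complex.exp (2 * φ * Complex.I)) t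
  rw [← Complex.exp_nat_mul] at h
  have e : (t : ℂ) * (2 * φ * Complex.I) = 2 * ((t * φ : ℝ) : ℂ) * Complex.I := by
    push_cast; ring
  rw [e] at h
  have h2 := congrArg norm h
  rw [norm_mul, norm_exp_two_mul_sub_one, norm_exp_two_mul_sub_one] at h2
  change ‖phaseSum t φ‖ * _ = _ at h2
  linarith

/-- The Dirichlet kernel dominates the sinc function. -/
lemma sinc_le_norm_phaseSum (t : ℕ) (ht : 0 < t) (z : ℝ) :
    |Real.sinc z| ≤ ‖phaseSum t (z / t)‖ / t := by
  have ht' : (0 : ℝ) < t := by exact_mod_cast ht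
  rcases eq_or_ne z 0 with rfl | hz
  · simp [phaseSum, ht'.ne']
  · have h := norm_phaseSum_mul_sin t (z / t)
    rw [mul_div_cancel₀ _ ht'.ne'] at h
    have h1 : |Real.sin (z / t)| ≤ |z| / t := by
      refine Real.abs_sin_le_abs.trans_eq ?_
      rw [abs_div, abs_of_pos ht']
    rw [Real.sinc_of_ne_zero hz, abs_div, div_le_iff₀ (abs_pos.2 hz), ← h]
    calc ‖phaseSum t (z / t)‖ * |Real.sin (z / t)| ≤ ‖phaseSum t (z / t)‖ * (|z| / t) := by gcongr
      _ = _ := by ring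

/-- The inequality behind the constant `8 / π ^ 2`, for the point at relative position `(1 ± v) / 2`
between two grid points; it is an equality at `v = 0` and at `v = 1`. -/
lemma sq_one_sub_sq_le_cos {v : ℝ} (h0 : 0 ≤ v) (h1 : v ≤ 1) :
    (1 - v ^ 2) ^ 2 ≤ Real.cos (Real.pi * v / 2) ^ 2 * (1 + v ^ 2) := by
  have hpi := Real.pi_gt_d2
  have hpi2 := Real.pi_lt_d4
  rcases le_or_gt v 0.62 with hv | hv
  · -- near `0`, the bound `1 - x ^ 2 / 2 ≤ cos x` is good enough
    have h := Real.one_sub_sq_div_two_le_cos (x := Real.pi * v / 2)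
    have hr : v ^ 2 ≤ 0.3844 := by nlinarith
    have hpq : Real.pi ^ 2 ≤ 9.8697 := by nlinarith
    have h2 : 1 - 1.2338 * v ^ 2 ≤ Real.cos (Real.pi * v / 2) := by nlinarith [sq_nonneg v]
    have h3 : 0 ≤ 1 - 1.2338 * v ^ 2 := by nlinarith
    have h4 : (1 - 1.2338 * v ^ 2) ^ 2 ≤ Real.cos (Real.pi * v / 2) ^ 2 :=
      pow_le_pow_left₀ h3 h2 2
    have h5 : (1 - v ^ 2) ^ 2 ≤ (1 - 1.2338 * v ^ 2) ^ 2 * (1 + v ^ 2) := by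
      set r := v ^ 2
      have hr0 : 0 ≤ r := sq_nonneg v
      have : 0 ≤ r *
          ((3 - 2 * 1.2338) + (1.2338 ^ 2 - 2 * 1.2338 - 1) * r + 1.2338 ^ 2 * r ^ 2) := by
        apply mul_nonneg hr0
        nlinarith [mul_nonneg (sub_nonneg.2 hr) (by linarith : 0 ≤ 0.8 - r)]
      nlinarith
    nlinarith [sq_nonneg v]
  · -- near `1`, use `z - z ^ 3 / 6 ≤ sin z` for `z = π (1 - v) / 2`
    rcases eq_or_lt_of_le h1 with rfl | h1
    · norm_num
    set z := Real.pi * (1 - v) / 2 with hz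
    have hz0 : 0 < z := by rw [hz]; nlinarith
    have hz1 : z ≤ 0.6 := by rw [hz]; nlinarith
    have hs := Real.sin_gt_sub_cube hz0
    have hc : Real.cos (Real.pi * v / 2) = Real.sin z := by
      rw [← Real.cos_pi_div_two_sub, hz]; congr 1; ring
    rw [hc]
    have h2 : 1.42 * (1 - v) ≤ Real.sin z := by
      have : 0.94 * z ≤ Real.sin z := by nlinarith [mul_pos hz0 hz0]
      have : 1.42 * (1 - v) ≤ 0.94 * z := by rw [hz]; nlinarith
      linarith
    have h3 : (1.42 * (1 - v)) ^ 2 ≤ Real.sin z ^ 2 := pow_le_pow_left₀ (by linarith) h2 2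
    have h4 : (1 + v) ^ 2 ≤ 2 * (1 + v ^ 2) := by nlinarith [sq_nonneg (1 - v)]
    calc (1 - v ^ 2) ^ 2 = (1 - v) ^ 2 * (1 + v) ^ 2 := by ring
      _ ≤ (1 - v) ^ 2 * (2 * (1 + v ^ 2)) := by gcongr
      _ ≤ (1.42 * (1 - v)) ^ 2 * (1 + v ^ 2) := by
        nlinarith [mul_nonneg (sq_nonneg (1 - v)) (by positivity : 0 ≤ 1 + v ^ 2)]
      _ ≤ _ := by gcongr

/-- The two grid points nearest to a phase carry at least `8 / π ^ 2` of the mass of the Fejér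
kernel. -/
lemma le_sinc_sq_add_sinc_sq {x : ℝ} (h0 : 0 ≤ x) (h1 : x < 1) :
    8 / Real.pi ^ 2 ≤ Real.sinc (Real.pi * x) ^ 2 + Real.sinc (Real.pi * (x - 1)) ^ 2 := by
  have hpi := Real.pi_pos
  rcases eq_or_lt_of_le h0 with rfl | h0
  · have : 8 / Real.pi ^ 2 ≤ 1 := by
      rw [div_le_one (by positivity)]; nlinarith [Real.pi_gt_three]
    simp only [mul_zero, Real.sinc_zero, one_pow]
    exact this.trans (le_add_of_nonneg_right (sq_nonneg _))
  have hs : Real.sin (Real.pi * (x - 1)) = - Real.sin (Real.pi * x) := by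
    rw [mul_sub, mul_one, Real.sin_sub_pi]
  have hx1 : x - 1 ≠ 0 := by linarith
  rw [Real.sinc_of_ne_zero (by positivity), Real.sinc_of_ne_zero (mul_ne_zero hpi.ne' hx1), hs]
  have hkey : 8 * (x * (1 - x)) ^ 2 ≤ Real.sin (Real.pi * x) ^ 2 * (1 - 2 * (x * (1 - x))) := by
    have h := sq_one_sub_sq_le_cos (abs_nonneg (2 * x - 1)) (abs_le.2 ⟨by linarith, by linarith⟩)
    have hc : Real.cos (Real.pi * |2 * x - 1| / 2) = Real.sin (Real.pi * x) := by
      have : Real.pi * |2 * x - 1| / 2 = |Real.pi * x - Real.pi / 2| := by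
        have : Real.pi * x - Real.pi / 2 = Real.pi / 2 * (2 * x - 1) := by ring
        rw [this, abs_mul, abs_of_pos Real.pi_div_two_pos]; ring
      rw [this, Real.cos_abs, Real.cos_sub_pi_div_two]
    rw [hc, sq_abs] at h
    nlinarith
  have e : (Real.sin (Real.pi * x) / (Real.pi * x)) ^ 2
      + (-Real.sin (Real.pi * x) / (Real.pi * (x - 1))) ^ 2
      = (Real.sin (Real.pi * x) ^ 2 * (1 - 2 * (x * (1 - x)))) / (x * (1 - x)) ^ 2
          / Real.pi ^ 2 := by
    have : 1 - x ≠ 0 := by linarith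
    field_simp
    ring
  rw [e]
  gcongr
  rw [le_div_iff₀ (by have : 0 < 1 - x := by linarith
                      positivity)]
  exact hkey

lemma le_sinc_sq {z : ℝ} (h : |z| ≤ Real.pi / 4) : 8 / Real.pi ^ 2 ≤ Real.sinc z ^ 2 := by
  have hpi := Real.pi_pos
  have hpi3 := Real.pi_gt_three
  wlog hz : 0 ≤ z generalizing z
  · rw [← Real.sinc_neg]
    exact this (by rwa [abs_neg]) (by linarith)
  rcases eq_or_lt_of_le hz with rfl | hz
  · rw [Real.sinc_zero, div_le_iff₀ (by positivity)]
    nlinarith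
  rw [abs_of_pos hz] at h
  rw [Real.sinc_of_ne_zero hz.ne']
  -- `sin` is concave on `[0, π / 4]`
  have hmem0 : (0 : ℝ) ∈ Set.Icc 0 Real.pi := ⟨le_rfl, hpi.le⟩
  have hmem1 : Real.pi / 4 ∈ Set.Icc 0 Real.pi := ⟨by positivity, by linarith⟩
  have hle : z / (Real.pi / 4) ≤ 1 := (div_le_one (by positivity)).2 h
  have hconc := strictConcaveOn_sin_Icc.concaveOn.2 hmem0 hmem1 (sub_nonneg.2 hle)
    (by positivity : 0 ≤ z / (Real.pi / 4)) (by ring)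
  have e : z / (Real.pi / 4) * (Real.pi / 4) = z := by field_simp
  simp only [smul_eq_mul, mul_zero, Real.sin_zero, zero_add, e, Real.sin_pi_div_four] at hconc
  have h2 : (z / (Real.pi / 4) * (√2 / 2)) ^ 2 ≤ Real.sin z ^ 2 :=
    pow_le_pow_left₀ (by positivity) hconc 2
  rw [div_pow, le_div_iff₀ (by positivity)]
  refine le_trans (le_of_eq ?_) h2
  have h4 : (√2 : ℝ) ^ 2 = 2 := Real.sq_sqrt (by norm_num)
  field_simp
  rw [h4]
  norm_num

/-- The Fejér kernel `|t⁻¹ ∑_{j < t} exp (2 i j (φ - π y / t))| ^ 2`: the distribution of the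
outcome of phase estimation with phase `φ / π`. -/
noncomputable def fejer (t : ℕ) (φ : ℝ) (y : ℕ) : ℝ :=
  (‖phaseSum t (φ - Real.pi * y / t)‖ / t) ^ 2

lemma fejer_nonneg (t : ℕ) (φ : ℝ) (y : ℕ) : 0 ≤ fejer t φ y := sq_nonneg _

/-- Every integer `n` has a representative `y < t` modulo `t`. -/
lemma exists_fin_eq_sub {t : ℕ} (ht : 0 < t) (n : ℤ) :
    ∃ (y : Fin t) (m : ℤ), ((y : ℕ) : ℤ) = n - t * m := by
  have ht' : (0 : ℤ) < t := by exact_mod_cast ht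
  have h0 := Int.emod_nonneg n ht'.ne'
  have h1 := Int.emod_lt_of_pos n ht'
  refine ⟨⟨(n % t).toNat, by omega⟩, n / t, ?_⟩
  have := Int.emod_add_mul_ediv n t
  simp only [Int.toNat_of_nonneg h0]
  linarith

lemma sinc_sq_le_fejer {t : ℕ} (ht : 0 < t) (φ : ℝ) {y : ℕ} {n m : ℤ} (h : (y : ℤ) = n - t * m) :
    Real.sinc (t * φ - Real.pi * n) ^ 2 ≤ fejer t φ y := by
  have ht' : (0 : ℝ) < t := by exact_mod_cast ht
  have hy : (y : ℝ) = n - t * m := by exact_mod_cast h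
  have e : φ - Real.pi * y / t = (t * φ - Real.pi * n) / t + m * Real.pi := by
    rw [hy]; field_simp; ring
  rw [fejer, e, phaseSum_add_int_mul_pi, ← sq_abs (Real.sinc _)]
  exact pow_le_pow_left₀ (abs_nonneg _) (sinc_le_norm_phaseSum t ht _) 2

lemma sin_sq_eq_of_eq_sub {t : ℕ} (ht : 0 < t) {y : ℕ} {n m : ℤ} (h : (y : ℤ) = n - t * m) :
    Real.sin (Real.pi * y / t) ^ 2 = Real.sin (Real.pi * n / t) ^ 2 := by
  have ht' : (0 : ℝ) < t := by exact_mod_cast ht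
  have hy : (y : ℝ) = n - t * m := by exact_mod_cast h
  have e : Real.pi * y / t = Real.pi * n / t - m * Real.pi := by
    rw [hy]; field_simp
  rw [e, Real.sin_sq_eq_half_sub, Real.sin_sq_eq_half_sub]
  have e2 : 2 * (Real.pi * n / t - m * Real.pi) = 2 * (Real.pi * n / t) - m * (2 * Real.pi) := by
    ring
  rw [e2, Real.cos_sub_int_mul_two_pi]

lemma abs_sin_sq_sub_sin_sq_le {φ α d : ℝ} (h : |α - φ| ≤ d) :
    |Real.sin α ^ 2 - Real.sin φ ^ 2| ≤ 2 * d * |Real.sin φ| + d ^ 2 := by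
  have e : Real.sin α ^ 2 - Real.sin φ ^ 2
      = 2 * Real.sin φ * Real.cos φ * Real.cos (α - φ) * Real.sin (α - φ)
        + (1 - 2 * Real.sin φ ^ 2) * Real.sin (α - φ) ^ 2 := by
    have h1 : α = φ + (α - φ) := by ring
    have h2 := Real.sin_sq_add_cos_sq φ
    have h3 := Real.sin_sq_add_cos_sq (α - φ)
    conv_lhs => rw [h1, Real.sin_add]
    linear_combination (Real.sin φ ^ 2) * h3 + Real.sin (α - φ) ^ 2 * h2
  have hs : |Real.sin (α - φ)| ≤ d := Real.abs_sin_le_abs.trans h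
  have hd : 0 ≤ d := (abs_nonneg _).trans h
  rw [e]
  refine (abs_add_le _ _).trans (add_le_add ?_ ?_)
  · rw [abs_mul, abs_mul, abs_mul, abs_mul, abs_two]
    calc 2 * |Real.sin φ| * |Real.cos φ| * |Real.cos (α - φ)| * |Real.sin (α - φ)|
        ≤ 2 * |Real.sin φ| * 1 * 1 * d := by
          gcongr
          · exact Real.abs_cos_le_one _
          · exact Real.abs_cos_le_one _
      _ = _ := by ring
  · rw [abs_mul, abs_pow]
    have h5 : |1 - 2 * Real.sin φ ^ 2| ≤ 1 := by
      have := Real.sin_sq_le_one φ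
      rw [abs_le]; constructor <;> nlinarith [sq_nonneg (Real.sin φ)]
    calc |1 - 2 * Real.sin φ ^ 2| * |Real.sin (α - φ)| ^ 2 ≤ 1 * d ^ 2 := by gcongr
      _ = _ := one_mul _

/-- Phase estimation: with probability at least `8 / π ^ 2`, the outcome is one of the two grid
points nearest to the phase. -/
lemma le_sum_fejer {t : ℕ} (ht : 2 ≤ t) (φ : ℝ) (s : Finset (Fin t))
    (hs : ∀ y : Fin t, |Real.sin (Real.pi * (y : ℕ) / t) ^ 2 - Real.sin φ ^ 2|
      ≤ 2 * (Real.pi / t) * |Real.sin φ| + (Real.pi / t) ^ 2 → y ∈ s) :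
    8 / Real.pi ^ 2 ≤ ∑ y ∈ s, fejer t φ y := by
  have ht0 : 0 < t := by omega
  have ht' : (0 : ℝ) < t := by exact_mod_cast ht0
  have hpi := Real.pi_pos
  set n : ℤ := ⌊t * φ / Real.pi⌋ with hn
  have hn0 : (n : ℝ) ≤ t * φ / Real.pi := Int.floor_le _
  have hn1 : t * φ / Real.pi < n + 1 := Int.lt_floor_add_one _
  obtain ⟨y₀, m₀, h₀⟩ := exists_fin_eq_sub ht0 n
  obtain ⟨y₁, m₁, h₁⟩ := exists_fin_eq_sub ht0 (n + 1)
  have hne : y₀ ≠ y₁ := by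
    intro h
    rw [h, h₁] at h₀
    have h2 : (t : ℤ) * (m₁ - m₀) = 1 := by linarith
    have := Int.le_of_dvd one_pos (Dvd.intro _ h2)
    omega
  have hmem : ∀ (y : Fin t) (k m : ℤ), ((y : ℕ) : ℤ) = k - t * m →
      |(k : ℝ) - t * φ / Real.pi| ≤ 1 → y ∈ s := by
    intro y k m h hk
    refine hs y ?_
    rw [sin_sq_eq_of_eq_sub ht0 h]
    refine abs_sin_sq_sub_sin_sq_le ?_
    have e : Real.pi * k / t - φ = Real.pi / t * (k - t * φ / Real.pi) := by field_simp
    rw [e, abs_mul, abs_of_pos (by positivity)]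
    exact mul_le_of_le_one_right (by positivity) hk
  have m0 := hmem y₀ n m₀ h₀ (abs_le.2 ⟨by linarith, by linarith⟩)
  have m1 := hmem y₁ (n + 1) m₁ h₁ (by push_cast; exact abs_le.2 ⟨by linarith, by linarith⟩)
  have f0 := sinc_sq_le_fejer ht0 φ h₀
  have f1 := sinc_sq_le_fejer ht0 φ h₁
  have hsum : fejer t φ y₀ + fejer t φ y₁ ≤ ∑ y ∈ s, fejer t φ y := by
    rw [← Finset.sum_pair (f := fun y : Fin t => fejer t φ y) hne]
    refine Finset.sum_le_sum_of_subset_of_nonneg ?_ fun _ _ _ => fejer_nonneg _ _ _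
    intro y hy
    rcases Finset.mem_insert.1 hy with rfl | hy
    · exact m0
    · rw [Finset.mem_singleton.1 hy]; exact m1
  have hx := le_sinc_sq_add_sinc_sq (x := t * φ / Real.pi - n) (by linarith) (by linarith)
  have e0 : Real.pi * (t * φ / Real.pi - n) = t * φ - Real.pi * n := by field_simp
  have e1 : Real.pi * (t * φ / Real.pi - n - 1) = t * φ - Real.pi * ((n + 1 : ℤ) : ℝ) := by
    push_cast; field_simp; ring
  rw [e0, e1] at hx
  linarith

lemma le_fejer_zero {t : ℕ} (ht : 0 < t) {φ : ℝ} (h : |t * φ| ≤ Real.pi / 4) :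
    8 / Real.pi ^ 2 ≤ fejer t φ 0 := by
  have h2 := sinc_sq_le_fejer (n := 0) (m := 0) (y := 0) ht φ (by simp)
  rw [Int.cast_zero, mul_zero, sub_zero] at h2
  exact (le_sinc_sq h).trans h2

/-! ### The Grover iterate -/

section Grover

variable {E : Type u} [NormedAddCommGroup E] [InnerProductSpace ℂ E]

/-- The Grover iterate is a rotation by `2 θ` of the plane spanned by `g₀` and `g₁`. One of these
vectors may vanish, when its coefficient in `ψ` does. -/
lemma iterate_grover_apply {Q : E → E} {W : E ≃ₗᵢ[ℂ] E} {ψ g₀ g₁ : E} {θ : ℝ}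
    (hQ : ∀ x, Q x = (2 * inner ℂ ψ (W x)) • ψ - W x)
    (hψ : ψ = (Real.cos θ : ℂ) • g₀ + (Real.sin θ : ℂ) • g₁) (hW₀ : W g₀ = g₀) (hW₁ : W g₁ = -g₁)
    (h₀ : inner ℂ ψ g₀ = (Real.cos θ : ℂ)) (h₁ : inner ℂ ψ g₁ = (Real.sin θ : ℂ)) (j : ℕ) :
    Q^[j] ψ = (Real.cos ((2 * j + 1) * θ) : ℂ) • g₀ + (Real.sin ((2 * j + 1) * θ) : ℂ) • g₁ := by
  induction j with
  | zero => simp [hψ]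
  | succ j ih =>
    have hW : W ((Real.cos ((2 * j + 1) * θ) : ℂ) • g₀ + (Real.sin ((2 * j + 1) * θ) : ℂ) • g₁)
        = (Real.cos ((2 * j + 1) * θ) : ℂ) • g₀ - (Real.sin ((2 * j + 1) * θ) : ℂ) • g₁ := by
      rw [map_add, map_smul, map_smul, hW₀, hW₁, smul_neg, sub_eq_add_neg]
    rw [Function.iterate_succ_apply', ih, hQ, hW, inner_sub_right, inner_smul_right,
      inner_smul_right, h₀, h₁, hψ]
    have e : (2 * ((j + 1 : ℕ) : ℝ) + 1) * θ = (2 * j + 1) * θ + 2 * θ := by push_cast; ring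
    have ec : (Real.cos ((2 * ((j + 1 : ℕ) : ℝ) + 1) * θ) : ℂ)
        = 2 * ((Real.cos ((2 * j + 1) * θ) : ℂ) * Real.cos θ
            - (Real.sin ((2 * j + 1) * θ) : ℂ) * Real.sin θ) * Real.cos θ
          - Real.cos ((2 * j + 1) * θ) := by
      rw [e, Real.cos_add, Real.cos_two_mul, Real.sin_two_mul]; push_cast; ring
    have es : (Real.sin ((2 * ((j + 1 : ℕ) : ℝ) + 1) * θ) : ℂ)
        = 2 * ((Real.cos ((2 * j + 1) * θ) : ℂ) * Real.cos θ
            - (Real.sin ((2 * j + 1) * θ) : ℂ) * Real.sin θ) * Real.sin θ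
          + Real.sin ((2 * j + 1) * θ) := by
      have hcs : (Real.cos θ : ℂ) ^ 2 = 1 - (Real.sin θ : ℂ) ^ 2 := by
        have := Real.sin_sq_add_cos_sq θ
        have h : (Real.sin θ : ℂ) ^ 2 + (Real.cos θ : ℂ) ^ 2 = 1 := by exact_mod_cast this
        linear_combination h
      rw [e, Real.sin_add, Real.cos_two_mul, Real.sin_two_mul]; push_cast
      push_cast at hcs
      linear_combination (2 * Complex.sin ((2 * j + 1) * θ)) * hcs
    rw [ec, es]
    module

lemma conj_fourierMatrix_mul (t : ℕ) (j y : Fin t) :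
    (starRingEnd ℂ) (fourierMatrix t j y) * ((Real.sqrt t : ℝ) : ℂ)⁻¹
      = (t : ℂ)⁻¹
        * Complex.exp (2 * ((-(Real.pi * (y : ℕ) / t) : ℝ) : ℂ) * Complex.I) ^ (j : ℕ) := by
  have hs : ((Real.sqrt t : ℝ) : ℂ)⁻¹ * ((Real.sqrt t : ℝ) : ℂ)⁻¹ = (t : ℂ)⁻¹ := by
    rw [← mul_inv, ← Complex.ofReal_mul, Real.mul_self_sqrt (Nat.cast_nonneg t)]
    simp
  simp only [fourierMatrix, Matrix.of_apply, map_mul, map_inv₀, Complex.conj_ofReal, map_pow]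
  rw [← Complex.exp_conj, ← hs, mul_comm (j : ℕ), pow_mul, ← Complex.exp_nat_mul _ (y : ℕ)]
  have : ((y : ℕ) : ℂ) * (starRingEnd ℂ) (2 * Real.pi * Complex.I / t)
      = 2 * ((-(Real.pi * (y : ℕ) / t) : ℝ) : ℂ) * Complex.I := by
    simp only [map_div₀, map_mul, Complex.conj_ofReal, Complex.conj_I, map_natCast, map_ofNat]
    push_cast
    ring
  rw [this]
  ring

/-- The coefficients of `g₀` and `g₁` in the final state of amplitude estimation, as combinations
of the amplitudes of phase estimation with phases `± θ / π`. -/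
lemma sum_phase_mul_cos_sin (t y : ℕ) (θ : ℝ) :
    let ω : ℂ := Complex.exp (2 * ((-(Real.pi * y / t) : ℝ) : ℂ) * Complex.I)
    let a : ℂ := Complex.exp (θ * Complex.I) * phaseSum t (θ - Real.pi * y / t) / t
    let b : ℂ := Complex.exp (-θ * Complex.I) * phaseSum t (-θ - Real.pi * y / t) / t
    ∑ j : Fin t, ((t : ℂ)⁻¹ * ω ^ (j : ℕ)) * (Real.cos ((2 * (j : ℕ) + 1) * θ) : ℂ) = (a + b) / 2 ∧
    ∑ j : Fin t, ((t : ℂ)⁻¹ * ω ^ (j : ℕ)) * (Real.sin ((2 * (j : ℕ) + 1) * θ) : ℂ)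
      = (b - a) * Complex.I / 2 := by
  intro ω a b
  have hp : ∀ (x : ℝ) (j : ℕ), Complex.exp (2 * ((x - Real.pi * y / t : ℝ) : ℂ) * Complex.I) ^ j
      = ω ^ j * Complex.exp (2 * j * x * Complex.I) := by
    intro x j
    rw [← Complex.exp_nat_mul, ← Complex.exp_nat_mul, ← Complex.exp_add]
    congr 1
    push_cast
    ring
  have ha : a = ∑ j : Fin t, (t : ℂ)⁻¹ * ω ^ (j : ℕ)
      * Complex.exp ((2 * (j : ℕ) + 1) * θ * Complex.I) := by
    simp only [a, phaseSum]
    rw [← Fin.sum_univ_eq_sum_range (fun j =>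
      Complex.exp (2 * ((θ - Real.pi * y / t : ℝ) : ℂ) * Complex.I) ^ j), Finset.mul_sum,
      Finset.sum_div]
    refine Finset.sum_congr rfl fun j _ => ?_
    have : Complex.exp ((2 * (j : ℕ) + 1) * θ * Complex.I)
        = Complex.exp (θ * Complex.I) * Complex.exp (2 * (j : ℕ) * θ * Complex.I) := by
      rw [← Complex.exp_add]; ring_nf
    rw [hp, this]
    ring
  have hb : b = ∑ j : Fin t, (t : ℂ)⁻¹ * ω ^ (j : ℕ)
      * Complex.exp (-((2 * (j : ℕ) + 1) * θ) * Complex.I) := by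
    simp only [b, phaseSum]
    rw [← Fin.sum_univ_eq_sum_range (fun j =>
      Complex.exp (2 * ((-θ - Real.pi * y / t : ℝ) : ℂ) * Complex.I) ^ j), Finset.mul_sum,
      Finset.sum_div]
    refine Finset.sum_congr rfl fun j _ => ?_
    have : Complex.exp (-((2 * (j : ℕ) + 1) * θ) * Complex.I)
        = Complex.exp (-θ * Complex.I) * Complex.exp (2 * (j : ℕ) * (-θ : ℝ) * Complex.I) := by
      rw [← Complex.exp_add]; push_cast; ring_nf
    rw [hp, this]
    ring
  rw [ha, hb, ← Finset.sum_add_distrib, ← Finset.sum_sub_distrib, Finset.sum_mul, Finset.sum_div,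
    Finset.sum_div]
  constructor <;> refine Finset.sum_congr rfl fun j _ => ?_
  · push_cast [Complex.cos]
    ring
  · push_cast [Complex.sin]
    ring

/-- Amplitude estimation is an equal mixture of phase estimations with phases `± θ / π`. -/
lemma norm_sq_sum_phase {t : ℕ} (y : Fin t) {g₀ g₁ : E} {θ : ℝ} (h01 : inner ℂ g₀ g₁ = 0)
    (h₀ : ‖g₀‖ = 1 ∨ θ = Real.pi / 2 ∧ g₀ = 0) (h₁ : ‖g₁‖ = 1 ∨ θ = 0 ∧ g₁ = 0) :
    ‖∑ j : Fin t, ((starRingEnd ℂ) (fourierMatrix t j y) * ((Real.sqrt t : ℝ) : ℂ)⁻¹) •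
        ((Real.cos ((2 * (j : ℕ) + 1) * θ) : ℂ) • g₀
          + (Real.sin ((2 * (j : ℕ) + 1) * θ) : ℂ) • g₁)‖ ^ 2
      = (fejer t θ y + fejer t (-θ) y) / 2 := by
  simp only [smul_add, Finset.sum_add_distrib, smul_smul, ← Finset.sum_smul,
    conj_fourierMatrix_mul]
  obtain ⟨hc, hs⟩ := sum_phase_mul_cos_sin t y θ
  set ω : ℂ := Complex.exp (2 * ((-(Real.pi * (y : ℕ) / t) : ℝ) : ℂ) * Complex.I)
  set a : ℂ := Complex.exp (θ * Complex.I) * phaseSum t (θ - Real.pi * (y : ℕ) / t) / t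
  set b : ℂ := Complex.exp (-θ * Complex.I) * phaseSum t (-θ - Real.pi * (y : ℕ) / t) / t
  set c : ℂ := ∑ j : Fin t, ((t : ℂ)⁻¹ * ω ^ (j : ℕ)) * (Real.cos ((2 * (j : ℕ) + 1) * θ) : ℂ)
    with hcdef
  set s : ℂ := ∑ j : Fin t, ((t : ℂ)⁻¹ * ω ^ (j : ℕ)) * (Real.sin ((2 * (j : ℕ) + 1) * θ) : ℂ)
    with hsdef
  have hfa : fejer t θ y = ‖a‖ ^ 2 := by
    simp only [fejer, a, norm_div, norm_mul, Complex.norm_exp_ofReal_mul_I, one_mul,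
      Complex.norm_natCast]
  have hfb : fejer t (-θ) y = ‖b‖ ^ 2 := by
    have := Complex.norm_exp_ofReal_mul_I (-θ)
    push_cast at this
    simp only [fejer, b, norm_div, norm_mul, this, one_mul, Complex.norm_natCast]
  have hcs : ‖c‖ ^ 2 + ‖s‖ ^ 2 = (‖a‖ ^ 2 + ‖b‖ ^ 2) / 2 := by
    have hp := parallelogram_law_with_norm ℝ a b
    rw [hc, hs, norm_div, norm_div, norm_mul, Complex.norm_I, Complex.norm_ofNat, norm_sub_rev b a]
    linear_combination hp / 4
  -- if `g₀` vanishes then so does its coefficient, and likewise for `g₁`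
  have hc₀ : ‖c • g₀‖ = ‖c‖ := by
    rcases h₀ with h | ⟨h, h'⟩
    · rw [norm_smul, h, mul_one]
    · have : c = 0 := by
        rw [hcdef]
        refine Finset.sum_eq_zero fun j _ => ?_
        have e : (2 * ((j : ℕ) : ℝ) + 1) * θ = ((j : ℕ) : ℝ) * Real.pi + Real.pi / 2 := by
          rw [h]; ring
        rw [e, Real.cos_add_pi_div_two, Real.sin_nat_mul_pi]
        simp
      simp [this]
  have hs₁ : ‖s • g₁‖ = ‖s‖ := by
    rcases h₁ with h | ⟨h, h'⟩
    · rw [norm_smul, h, mul_one]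
    · have : s = 0 := by
        rw [hsdef]
        exact Finset.sum_eq_zero fun j _ => by simp [h]
      simp [this]
  rw [@norm_add_sq ℂ, inner_smul_left, inner_smul_right, h01, hc₀, hs₁, hfa, hfb, ← hcs]
  simp

end Grover

section AmplitudeEstimation

variable {K : Type u} [NormedAddCommGroup K] [InnerProductSpace ℂ K]

/-- The decomposition of a unit vector of `ℂ² ⊗ K` along the flag qubit. -/
lemma exists_grover_decomposition (ψ : Reg (Fin 2) K) (hψ : ‖ψ‖ = 1) :
    ∃ (θ : ℝ) (g₀ g₁ : Reg (Fin 2) K), 0 ≤ θ ∧ θ ≤ Real.pi / 2 ∧ Real.sin θ = ‖ψ 1‖ ∧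
      ψ = (Real.cos θ : ℂ) • g₀ + (Real.sin θ : ℂ) • g₁ ∧
      flagReflection g₀ = g₀ ∧ flagReflection g₁ = -g₁ ∧
      inner ℂ ψ g₀ = (Real.cos θ : ℂ) ∧ inner ℂ ψ g₁ = (Real.sin θ : ℂ) ∧ inner ℂ g₀ g₁ = 0 ∧
      (‖g₀‖ = 1 ∨ θ = Real.pi / 2 ∧ g₀ = 0) ∧ (‖g₁‖ = 1 ∨ θ = 0 ∧ g₁ = 0) := by
  have hsum : ‖ψ 0‖ ^ 2 + ‖ψ 1‖ ^ 2 = 1 := by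
    rw [← Fin.sum_univ_two (f := fun q => ‖ψ q‖ ^ 2), ← reg_norm_sq, hψ, one_pow]
  have h1le : ‖ψ 1‖ ≤ 1 := by nlinarith [norm_nonneg (ψ 1), sq_nonneg ‖ψ 0‖]
  set θ := Real.arcsin ‖ψ 1‖ with hθ
  have hsin : Real.sin θ = ‖ψ 1‖ :=
    Real.sin_arcsin (by linarith [norm_nonneg (ψ 1)]) h1le
  have hcos : Real.cos θ = ‖ψ 0‖ := by
    rw [hθ, Real.cos_arcsin, ← Real.sqrt_sq (norm_nonneg (ψ 0))]
    congr 1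
    linarith
  have hθ0 : 0 ≤ θ := Real.arcsin_nonneg.2 (norm_nonneg _)
  have hθ1 : θ ≤ Real.pi / 2 := Real.arcsin_le_pi_div_two _
  have hnormal : ∀ x : K, (‖x‖ : ℂ) • ((‖x‖ : ℂ)⁻¹ • x) = x := by
    intro x
    rcases eq_or_ne x 0 with rfl | hx
    · simp
    · rw [smul_smul, mul_inv_cancel₀ (by simpa using hx), one_smul]
  have hinner : ∀ x : K, inner ℂ x ((‖x‖ : ℂ)⁻¹ • x) = (‖x‖ : ℂ) := by
    intro x
    rcases eq_or_ne x 0 with rfl | hx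
    · simp
    · have : (‖x‖ : ℂ) ≠ 0 := by simpa using hx
      rw [inner_smul_right, inner_self_eq_norm_sq_to_K]
      change (‖x‖ : ℂ)⁻¹ * (‖x‖ : ℂ) ^ 2 = _
      field_simp
  have hsingle : ∀ (q : Fin 2) (y : K), inner ℂ ψ (PiLp.single 2 q y) = inner ℂ (ψ q) y := by
    intro q y
    rw [PiLp.inner_apply, Fin.sum_univ_two]
    fin_cases q <;> simp
  have hnorm : ∀ x : K, ‖(‖x‖ : ℂ)⁻¹ • x‖ = 1 ∨ x = 0 := by
    intro x
    rcases eq_or_ne x 0 with hx | hx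
    · exact Or.inr hx
    · left
      rw [norm_smul, norm_inv, Complex.norm_real, norm_norm,
        inv_mul_cancel₀ (norm_ne_zero_iff.2 hx)]
  refine ⟨θ, PiLp.single 2 0 ((‖ψ 0‖ : ℂ)⁻¹ • ψ 0), PiLp.single 2 1 ((‖ψ 1‖ : ℂ)⁻¹ • ψ 1), hθ0,
    hθ1, hsin, ?_, ?_, ?_, ?_, ?_, ?_, ?_, ?_⟩
  · rw [hsin, hcos]
    ext q
    fin_cases q
    · simpa using (hnormal (ψ 0)).symm
    · simpa using (hnormal (ψ 1)).symm
  · ext q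
    fin_cases q <;> simp [flagReflection, controlled_apply]
  · ext q
    fin_cases q <;> simp [flagReflection, controlled_apply]
  · rw [hcos, hsingle, hinner]
  · rw [hsin, hsingle, hinner]
  · rw [PiLp.inner_apply, Fin.sum_univ_two]
    simp
  · rw [PiLp.norm_single]
    refine (hnorm (ψ 0)).imp id fun h => ⟨?_, by simp [h]⟩
    rw [h, norm_zero] at hsum
    have : ‖ψ 1‖ = 1 := by nlinarith [norm_nonneg (ψ 1)]
    rw [hθ, this, Real.arcsin_one]
  · rw [PiLp.norm_single]
    refine (hnorm (ψ 1)).imp id fun h => ⟨?_, by simp [h]⟩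
    rw [hθ, h, norm_zero, Real.arcsin_zero]

/-- The distribution of the phase register at the end of amplitude estimation. -/
lemma norm_sq_amplitudeCircuit (S : K ≃ₗᵢ[ℂ] K) (U : Circuit (Fin 2) K) (v : Reg (Fin 2) K)
    (hv : ‖v‖ = 1) :
    ∃ θ : ℝ, 0 ≤ θ ∧ θ ≤ Real.pi / 2 ∧ Real.sin θ = ‖Circuit.eval S U v 1‖ ∧
      ∀ (t : ℕ) (ht : 0 < t) (y : Fin t),
        ‖curryReg (Circuit.eval S (amplitudeCircuit U v flagReflection t)
          (curryReg.symm (PiLp.single 2 (⟨0, ht⟩ : Fin t) v))) y‖ ^ 2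
          = (fejer t θ y + fejer t (-θ) y) / 2 := by
  obtain ⟨θ, g₀, g₁, hθ0, hθ1, hsin, hψ, hW0, hW1, h0, h1, h01, hn0, hn1⟩ :=
    exists_grover_decomposition (Circuit.eval S U v) (by rw [LinearIsometryEquiv.norm_map, hv])
  refine ⟨θ, hθ0, hθ1, hsin, fun t ht y => ?_⟩
  rw [curryReg_eval_amplitudeCircuit, ← norm_sq_sum_phase y h01 hn0 hn1]
  congr 2
  refine Finset.sum_congr rfl fun j _ => ?_
  rw [iterate_grover_apply (eval_groverIterate S U v hv flagReflection) hψ hW0 hW1 h0 h1]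

end AmplitudeEstimation

/-! ### Probabilities of bad events -/

section Probability

open ENNReal

variable {H : Type u} [NormedAddCommGroup H] [InnerProductSpace ℂ H] {α β : Type}

/-- The probability that the output of an algorithm lies in `s`. -/
noncomputable def Prog.prob (S : H ≃ₗᵢ[ℂ] H) (p : Prog H α) (s : Set α) : ℝ≥0∞ :=
  (p.law S).toOuterMeasure s

lemma Prog.law_bind (S : H ≃ₗᵢ[ℂ] H) (p : Prog H α) (f : α → Prog H β) :
    (p >>= f).law S = (p.law S).bind fun x => (f x).law S := by
  induction p with
  | ret x => exact (PMF.pure_bind x fun x => (f x).law S).symm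
  | run A init h c next ih =>
    change (PMF.bind _ fun a => ((next a) >>= f).law S) = PMF.bind (PMF.bind _ _) _
    rw [PMF.bind_bind]
    congr 1
    funext a
    exact ih a

lemma Prog.law_pure (S : H ≃ₗᵢ[ℂ] H) (x : α) : (pure x : Prog H α).law S = PMF.pure x := rfl

lemma toOuterMeasure_le_one (p : PMF α) (s : Set α) : p.toOuterMeasure s ≤ 1 := by
  rw [PMF.toOuterMeasure_apply, ← p.tsum_coe]
  exact ENNReal.tsum_le_tsum fun a => Set.indicator_le_self' (fun _ _ => zero_le) a

lemma Prog.prob_le_one (S : H ≃ₗᵢ[ℂ] H) (p : Prog H α) (s : Set α) : p.prob S s ≤ 1 :=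
  toOuterMeasure_le_one _ _

lemma Prog.prob_mono (S : H ≃ₗᵢ[ℂ] H) (p : Prog H α) {s t : Set α} (h : s ⊆ t) :
    p.prob S s ≤ p.prob S t :=
  (p.law S).toOuterMeasure.mono h

lemma Prog.prob_pure_of_notMem (S : H ≃ₗᵢ[ℂ] H) {x : α} {s : Set α} (h : x ∉ s) :
    (pure x : Prog H α).prob S s = 0 := by
  rw [Prog.prob, Prog.law_pure, PMF.toOuterMeasure_pure_apply, if_neg h]

lemma Prog.prob_bind (S : H ≃ₗᵢ[ℂ] H) (p : Prog H α) (f : α → Prog H β) (s : Set β) :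
    (p >>= f).prob S s = ∑' x, p.law S x * (f x).prob S s := by
  rw [Prog.prob, Prog.law_bind, PMF.toOuterMeasure_bind_apply]
  rfl

lemma Prog.prob_bind_pure (S : H ≃ₗᵢ[ℂ] H) (p : Prog H α) (f : α → β) (s : Set β) :
    (p >>= fun x => pure (f x)).prob S s = p.prob S (f ⁻¹' s) := by
  rw [Prog.prob_bind, Prog.prob, PMF.toOuterMeasure_apply]
  refine tsum_congr fun x => ?_
  rw [Prog.prob, Prog.law_pure, PMF.toOuterMeasure_pure_apply]
  by_cases h : f x ∈ s
  · rw [if_pos h, Set.indicator_of_mem (by exact h), mul_one]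
  · rw [if_neg h, Set.indicator_of_notMem (by exact h), mul_zero]

/-- The union bound for a sequence of two algorithms, the second one depending on the output of the
first. -/
lemma Prog.prob_bind_le (S : H ≃ₗᵢ[ℂ] H) (p : Prog H α) (f : α → Prog H β) (A : Set α) (B : Set β)
    {a b : ℝ≥0∞} (hA : p.prob S A ≤ a) (hB : ∀ x ∉ A, (f x).prob S B ≤ b) :
    (p >>= f).prob S B ≤ a + b := by
  rw [Prog.prob_bind]
  calc ∑' x, p.law S x * (f x).prob S B
      ≤ ∑' x, (A.indicator (p.law S) x + p.law S x * b) := by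
        refine ENNReal.tsum_le_tsum fun x => ?_
        by_cases h : x ∈ A
        · rw [Set.indicator_of_mem h]
          refine le_trans ?_ le_self_add
          exact mul_le_of_le_one_right zero_le (Prog.prob_le_one _ _ _)
        · refine le_trans ?_ le_add_self
          gcongr
          exact hB x h
    _ = p.prob S A + b := by
        rw [ENNReal.tsum_add, ENNReal.tsum_mul_right, PMF.tsum_coe, one_mul, Prog.prob,
          PMF.toOuterMeasure_apply]
    _ ≤ a + b := by gcongr

lemma Prog.prob_bind_le_mul (S : H ≃ₗᵢ[ℂ] H) (p : Prog H α) (f : α → Prog H β) (A : Set α)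
    (B : Set β) {b : ℝ≥0∞} (hA : ∀ x ∉ A, (f x).prob S B = 0) (hB : ∀ x, (f x).prob S B ≤ b) :
    (p >>= f).prob S B ≤ p.prob S A * b := by
  rw [Prog.prob_bind, Prog.prob, PMF.toOuterMeasure_apply, ← ENNReal.tsum_mul_right]
  refine ENNReal.tsum_le_tsum fun x => ?_
  by_cases h : x ∈ A
  · rw [Set.indicator_of_mem h]
    gcongr
    exact hB x
  · rw [hA x h, mul_zero]
    exact zero_le

lemma Prog.collect_succ (n : ℕ) (p : Fin (n + 1) → Prog H α) :
    Prog.collect (n + 1) p = p 0 >>= fun x =>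
      Prog.collect n (fun i => p i.succ) >>= fun xs => pure (Fin.cons x xs : Fin (n + 1) → α) :=
  rfl

/-- The union bound for a tuple of algorithms. -/
lemma Prog.prob_collect_exists_le (S : H ≃ₗᵢ[ℂ] H) (n : ℕ) (p : Fin n → Prog H α)
    (A : Fin n → Set α) {a : ℝ≥0∞} (h : ∀ i, (p i).prob S (A i) ≤ a) :
    (Prog.collect n p).prob S {xs | ∃ i, xs i ∈ A i} ≤ n * a := by
  induction n with
  | zero =>
    refine le_of_eq_of_le (Prog.prob_pure_of_notMem S ?_) zero_le
    rintro ⟨i, -⟩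
    exact i.elim0
  | succ n ih =>
    rw [Prog.collect_succ]
    refine (Prog.prob_bind_le S _ _ (A 0) _ (h 0) (b := n * a) fun x hx => ?_).trans_eq ?_
    · rw [Prog.prob_bind_pure]
      refine le_trans (Prog.prob_mono S _ ?_) (ih (fun i => p i.succ) (fun i => A i.succ)
        fun i => h i.succ)
      rintro xs ⟨i, hi⟩
      refine Fin.cases (fun hi => ?_) (fun i hi => ?_) i hi
      · exact absurd (by simpa using hi) hx
      · exact ⟨i, by simpa using hi⟩
    · push_cast
      ring

/-- Independence of the members of a tuple of algorithms. -/
lemma Prog.prob_collect_forall_le (S : H ≃ₗᵢ[ℂ] H) (n : ℕ) (p : Fin n → Prog H α)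
    (A : Set α) {a : ℝ≥0∞} (h : ∀ i, (p i).prob S A ≤ a) (I : Finset (Fin n)) :
    (Prog.collect n p).prob S {xs | ∀ i ∈ I, xs i ∈ A} ≤ a ^ I.card := by
  induction n with
  | zero =>
    have : I = ∅ := Finset.eq_empty_of_isEmpty I
    rw [this, Finset.card_empty, pow_zero]
    exact Prog.prob_le_one _ _ _
  | succ n ih =>
    have ih' := ih (fun i => p i.succ) (fun i => h i.succ)
      (I.preimage Fin.succ (Fin.succ_injective n).injOn)
    set J : Finset (Fin n) := I.preimage Fin.succ (Fin.succ_injective n).injOn with hJ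
    have hstep : ∀ x : α, (Prog.collect n (fun i => p i.succ) >>= fun xs =>
        pure (Fin.cons x xs : Fin (n + 1) → α)).prob S {xs | ∀ i ∈ I, xs i ∈ A} ≤ a ^ J.card := by
      intro x
      rw [Prog.prob_bind_pure]
      refine le_trans (Prog.prob_mono S _ ?_) ih'
      intro xs hxs i hi
      simpa using hxs i.succ (by simpa [hJ] using hi)
    have hmap : (J.map (Fin.succEmb n)) = I.erase 0 := by
      ext i
      refine Fin.cases (by simp [Fin.succ_ne_zero]) (fun i => ?_) i
      simp [hJ, Fin.succ_ne_zero]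
    rw [Prog.collect_succ]
    by_cases h0 : (0 : Fin (n + 1)) ∈ I
    · have hcard : I.card = J.card + 1 := by
        rw [← Finset.card_erase_add_one h0, ← hmap, Finset.card_map]
      rw [hcard, pow_succ']
      refine (Prog.prob_bind_le_mul S _ _ A _ (fun x hx => ?_) hstep).trans ?_
      · rw [Prog.prob_bind_pure]
        refine le_antisymm (le_trans (Prog.prob_mono S _ (t := ∅) fun xs hxs => ?_) ?_) zero_le
        · exact hx (by simpa using hxs 0 h0)
        · simp [Prog.prob]
      · gcongr
        exact h 0
    · have hcard : I.card = J.card := by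
        rw [← Finset.erase_eq_of_notMem h0, ← hmap, Finset.card_map]
      rw [hcard]
      refine (Prog.prob_bind_le S _ _ ∅ _ (a := 0) (by simp [Prog.prob])
        fun x _ => hstep x).trans_eq (zero_add _)

lemma exists_card_of_median_notMem {m : ℕ} (v : Fin (2 * m + 1) → ℝ) (s : Set ℝ)
    (hs : s.OrdConnected) (h : median v ∉ s) :
    ∃ I : Finset (Fin (2 * m + 1)), I.card = m + 1 ∧ ∀ i ∈ I, v i ∈ sᶜ := by
  set σ := Tuple.sort v
  set c : Fin (2 * m + 1) := ⟨m, by omega⟩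
  have hmono : Monotone (v ∘ σ) := Tuple.monotone_sort v
  -- the values of `v` in `s` cannot lie on both sides of the median
  have hside : (∀ i ≤ c, (v ∘ σ) i ∉ s) ∨ ∀ i ≥ c, (v ∘ σ) i ∉ s := by
    by_contra! hcon
    obtain ⟨⟨i, hi, his⟩, j, hj, hjs⟩ := hcon
    exact h (hs.out his hjs ⟨hmono hi, hmono hj⟩)
  rcases hside with hside | hside
  · refine ⟨(Finset.Iic c).map σ.toEmbedding, by simp [c], fun i hi => ?_⟩
    obtain ⟨j, hj, rfl⟩ := Finset.mem_map.1 hi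
    exact hside j (Finset.mem_Iic.1 hj)
  · refine ⟨(Finset.Ici c).map σ.toEmbedding, by simp [c]; omega, fun i hi => ?_⟩
    obtain ⟨j, hj, rfl⟩ := Finset.mem_map.1 hi
    exact hside j (Finset.mem_Ici.1 hj)

/-- If each of `2 m + 1` independent runs misses an interval with probability at most `q`, then so
does their median with probability at most `4 ^ m * q ^ (m + 1)`. -/
lemma Prog.prob_median_le (S : H ≃ₗᵢ[ℂ] H) (m : ℕ) (p : Prog H ℝ) (s : Set ℝ)
    (hs : s.OrdConnected) {q : ℝ≥0∞} (hq : p.prob S sᶜ ≤ q) :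
    (Prog.collect (2 * m + 1) (fun _ => p) >>= fun ps => pure (median ps)).prob S sᶜ
      ≤ 4 ^ m * q ^ (m + 1) := by
  rw [Prog.prob_bind_pure]
  have hsub : median ⁻¹' sᶜ ⊆ ⋃ I ∈ (Finset.univ : Finset (Fin (2 * m + 1))).powersetCard (m + 1),
      {v : Fin (2 * m + 1) → ℝ | ∀ i ∈ I, v i ∈ sᶜ} := by
    intro v hv
    obtain ⟨I, hI, hv⟩ := exists_card_of_median_notMem v s hs hv
    simp only [Set.mem_iUnion]
    exact ⟨I, Finset.mem_powersetCard.2 ⟨Finset.subset_univ _, hI⟩, hv⟩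
  refine (Prog.prob_mono S _ hsub).trans ?_
  refine (MeasureTheory.measure_biUnion_finset_le _ _).trans ?_
  have hle : ∀ I ∈ (Finset.univ : Finset (Fin (2 * m + 1))).powersetCard (m + 1),
      ((Prog.collect (2 * m + 1) fun _ => p).law S).toOuterMeasure
        {v : Fin (2 * m + 1) → ℝ | ∀ i ∈ I, v i ∈ sᶜ} ≤ q ^ (m + 1) := by
    intro I hI
    rw [← (Finset.mem_powersetCard.1 hI).2]
    exact Prog.prob_collect_forall_le S _ _ _ (fun _ => hq) I
  refine (Finset.sum_le_card_nsmul _ _ _ hle).trans ?_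
  rw [Finset.card_powersetCard, Finset.card_univ, Fintype.card_fin, nsmul_eq_mul]
  gcongr
  have := Nat.choose_middle_le_pow m
  rw [Nat.choose_symm_half]
  exact_mod_cast this

end Probability

/-! ### The output of amplitude estimation -/

section AmplitudeEstimationLaw

open ENNReal

variable {K : Type u} [NormedAddCommGroup K] [InnerProductSpace ℂ K]

/-- If the phases `y ∈ Y`, which are observed with probability at least `q`, are all mapped into
`s`, then amplitude estimation misses `s` with probability at most `1 - q`. -/
lemma prob_amplitudeEstimation_compl_le {B : Type} [Fintype B] (S : K ≃ₗᵢ[ℂ] K)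
    (U : Circuit B K) (v : Reg B K) (hv : ‖v‖ = 1) (W : Reg B K ≃ₗᵢ[ℂ] Reg B K)
    {t : ℕ} (ht : 0 < t) (s : Set ℝ) (Y : Finset (Fin t)) (q : ℝ)
    (hY : ∀ y ∈ Y, Real.sin (Real.pi * (y : ℕ) / t) ^ 2 ∈ s)
    (hq : q ≤ ∑ y ∈ Y, ‖curryReg (Circuit.eval S (amplitudeCircuit U v W t)
          (curryReg.symm (PiLp.single 2 (⟨0, ht⟩ : Fin t) v))) y‖ ^ 2) :
    (amplitudeEstimation U v hv W t).prob S sᶜ ≤ ENNReal.ofReal (1 - q) := by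
  classical
  set w := Circuit.eval S (amplitudeCircuit U v W t)
    (curryReg.symm (PiLp.single 2 (⟨0, ht⟩ : Fin t) v)) with hw
  have hwn : ‖w‖ = 1 := by
    rw [hw, LinearIsometryEquiv.norm_map, LinearIsometryEquiv.norm_map, PiLp.norm_single, hv]
  have hlaw : (amplitudeEstimation U v hv W t).law S
      = (measure w hwn).bind fun i => PMF.pure (Real.sin (Real.pi * (i.1 : ℕ) / t) ^ 2) := by
    rw [amplitudeEstimation, dif_pos ht]
    rfl
  have hcompl : ∑ y ∈ Yᶜ, ‖curryReg w y‖ ^ 2 ≤ 1 - q := by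
    have h1 : ∑ y, ‖curryReg w y‖ ^ 2 = 1 := by
      rw [← reg_norm_sq, LinearIsometryEquiv.norm_map, hwn, one_pow]
    rw [← Finset.sum_add_sum_compl Y] at h1
    linarith
  rw [Prog.prob, hlaw, PMF.toOuterMeasure_bind_apply, tsum_fintype, Fintype.sum_prod_type,
    ← Finset.sum_add_sum_compl Y]
  have hzero : ∑ y ∈ Y, ∑ b, (measure w hwn) (y, b)
      * (PMF.pure (Real.sin (Real.pi * (y : ℕ) / t) ^ 2)).toOuterMeasure sᶜ = 0 := by
    refine Finset.sum_eq_zero fun y hy => Finset.sum_eq_zero fun b _ => ?_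
    rw [PMF.toOuterMeasure_pure_apply, if_neg (by simpa using hY y hy), mul_zero]
  rw [hzero, zero_add]
  calc ∑ y ∈ Yᶜ, ∑ b, (measure w hwn) (y, b)
      * (PMF.pure (Real.sin (Real.pi * (y : ℕ) / t) ^ 2)).toOuterMeasure sᶜ
      ≤ ∑ y ∈ Yᶜ, ∑ b, ENNReal.ofReal (‖w (y, b)‖ ^ 2) := by
        refine Finset.sum_le_sum fun y _ => Finset.sum_le_sum fun b _ => ?_
        exact mul_le_of_le_one_right zero_le (toOuterMeasure_le_one _ _)
    _ = ENNReal.ofReal (∑ y ∈ Yᶜ, ‖curryReg w y‖ ^ 2) := by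
        rw [ENNReal.ofReal_sum_of_nonneg fun _ _ => sq_nonneg _]
        refine Finset.sum_congr rfl fun y _ => ?_
        rw [reg_norm_sq, ENNReal.ofReal_sum_of_nonneg fun _ _ => sq_nonneg _]
        rfl
    _ ≤ _ := ENNReal.ofReal_le_ofReal hcompl

/-- The error bound of amplitude estimation. -/
lemma prob_amplitudeEstimation_error_le (S : K ≃ₗᵢ[ℂ] K)
    (U : Circuit (Fin 2) K) (v : Reg (Fin 2) K) (hv : ‖v‖ = 1) {t : ℕ} (ht : 2 ≤ t) :
    (amplitudeEstimation U v hv flagReflection t).prob S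
      {x : ℝ | |x - ‖Circuit.eval S U v 1‖ ^ 2|
        ≤ 2 * (Real.pi / t) * ‖Circuit.eval S U v 1‖ + (Real.pi / t) ^ 2}ᶜ
      ≤ ENNReal.ofReal (1 - 8 / Real.pi ^ 2) := by
  classical
  have ht0 : 0 < t := by omega
  obtain ⟨θ, -, -, hsin, h⟩ := norm_sq_amplitudeCircuit S U v hv
  set e := 2 * (Real.pi / t) * ‖Circuit.eval S U v 1‖ + (Real.pi / t) ^ 2
  refine prob_amplitudeEstimation_compl_le S U v hv _ ht0 _
    (Finset.univ.filter fun y : Fin t =>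
      |Real.sin (Real.pi * (y : ℕ) / t) ^ 2 - ‖Circuit.eval S U v 1‖ ^ 2| ≤ e) _
    (fun y hy => (Finset.mem_filter.1 hy).2) ?_
  simp only [h]
  rw [← Finset.sum_div, Finset.sum_add_distrib]
  have habs : |Real.sin θ| = ‖Circuit.eval S U v 1‖ := by rw [hsin, abs_of_nonneg (norm_nonneg _)]
  have h1 := le_sum_fejer ht θ (Finset.univ.filter fun y : Fin t =>
      |Real.sin (Real.pi * (y : ℕ) / t) ^ 2 - ‖Circuit.eval S U v 1‖ ^ 2| ≤ e) (by
    intro y hy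
    rw [habs, hsin] at hy
    simpa using hy)
  have h2 := le_sum_fejer ht (-θ) (Finset.univ.filter fun y : Fin t =>
      |Real.sin (Real.pi * (y : ℕ) / t) ^ 2 - ‖Circuit.eval S U v 1‖ ^ 2| ≤ e) (by
    intro y hy
    rw [Real.sin_neg, abs_neg, neg_sq, habs, hsin] at hy
    simpa using hy)
  linarith

/-- Amplitude estimation outputs exactly `0` on small amplitudes. -/
lemma prob_amplitudeEstimation_ne_zero_le (S : K ≃ₗᵢ[ℂ] K)
    (U : Circuit (Fin 2) K) (v : Reg (Fin 2) K) (hv : ‖v‖ = 1) {t : ℕ} (ht : 0 < t)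
    (hsmall : ‖Circuit.eval S U v 1‖ ≤ 1 / (2 * t)) :
    (amplitudeEstimation U v hv flagReflection t).prob S {0}ᶜ
      ≤ ENNReal.ofReal (1 - 8 / Real.pi ^ 2) := by
  have ht' : (0 : ℝ) < t := by exact_mod_cast ht
  obtain ⟨θ, hθ0, hθ1, hsin, h⟩ := norm_sq_amplitudeCircuit S U v hv
  refine prob_amplitudeEstimation_compl_le S U v hv _ ht _ {⟨0, ht⟩} _ ?_ ?_
  · intro y hy
    rw [Finset.mem_singleton.1 hy]
    simp
  · rw [Finset.sum_singleton, h]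
    have hle : (t : ℝ) * θ ≤ Real.pi / 4 := by
      have h1 := Real.mul_le_sin hθ0 hθ1
      rw [hsin] at h1
      have h2 := h1.trans hsmall
      rw [le_div_iff₀ (by positivity)] at h2
      have hpi := Real.pi_pos
      field_simp at h2
      linarith
    have h1 := le_fejer_zero ht (φ := θ) (by rwa [abs_of_nonneg (by positivity)])
    have h2 := le_fejer_zero ht (φ := -θ) (by
      rwa [mul_neg, abs_neg, abs_of_nonneg (by positivity)])
    change _ ≤ (fejer t θ 0 + fejer t (-θ) 0) / 2
    linarith

end AmplitudeEstimationLaw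

/-! ### Basic estimation -/

section BasicEstimation

open ENNReal

variable {Ω : Finset ℝ} {G : Type u} [NormedAddCommGroup G] [InnerProductSpace ℂ G]

/-- The quantity `E[X; a ≤ X < b] / b` which the basic estimation algorithm estimates. -/
noncomputable def Sampler.bucketMean (s : Sampler Ω G) (a b : ℝ) : ℝ :=
  ∑ x, s.d x * bernoulliParam a b x

lemma Sampler.bucketMean_nonneg (s : Sampler Ω G) (a b : ℝ) : 0 ≤ s.bucketMean a b :=
  Finset.sum_nonneg fun x _ =>
    mul_nonneg (s.d_nonneg x) (bernoulliParam_mem a b x (s.nonneg x x.2)).1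

lemma Sampler.norm_bernoulliSampler (s : Sampler Ω G) (a b : ℝ) :
    ‖Circuit.eval s.S [Gate.sample (fun _ => true), Gate.free (bernoulliSampler s.toRegisters a b)]
      (PiLp.single 2 (0 : Fin 2) s.zero) 1‖ = √(s.bucketMean a b) := by
  rw [← Real.sqrt_sq (norm_nonneg _)]
  congr 1
  rw [Circuit.eval_cons, Circuit.eval_cons, Circuit.eval_nil, Sampler.bucketMean, reg_norm_sq]
  refine Finset.sum_congr rfl fun x _ => ?_
  have h : (Gate.eval s.S (Gate.free (bernoulliSampler s.toRegisters a b))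
      ((Gate.sample fun _ => true : Gate (Fin 2) (Reg Ω G)).eval s.S
        (PiLp.single 2 (0 : Fin 2) s.zero))) 1 x
      = (√(bernoulliParam a b x) : ℂ) • (s.S s.zero) x := by
    change (√(bernoulliParam a b x) : ℂ) • (controlled (fun _ => true) s.S
        (PiLp.single 2 (0 : Fin 2) s.zero) 0) x
      + (√(1 - bernoulliParam a b x) : ℂ) • (controlled (fun _ => true) s.S
        (PiLp.single 2 (0 : Fin 2) s.zero) 1) x = _
    rw [controlled_apply, controlled_apply]
    simp
  have hp := (bernoulliParam_mem a b x (s.nonneg x x.2)).1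
  rw [h, norm_smul, mul_pow, s.born_rule, Complex.norm_real, Real.norm_eq_abs, sq_abs,
    Real.sq_sqrt hp, mul_comm]

/-- The number of repetitions is large enough for the median trick. -/
lemma four_pow_halfReps_mul_le {δ : ℝ} (h0 : 0 < δ) (h1 : δ ≤ 1) :
    (4 : ℝ≥0∞) ^ halfReps δ * ENNReal.ofReal (1 - 8 / Real.pi ^ 2) ^ (halfReps δ + 1)
      ≤ ENNReal.ofReal δ := by
  have hpi := Real.pi_gt_three
  have hpi2 := Real.pi_lt_d4
  have hq0 : 0 ≤ 1 - 8 / Real.pi ^ 2 := by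
    rw [sub_nonneg, div_le_one (by positivity)]
    nlinarith
  have hq : 1 - 8 / Real.pi ^ 2 ≤ 1 / 5 := by
    have : 4 / 5 ≤ 8 / Real.pi ^ 2 := by
      rw [le_div_iff₀ (by positivity)]
      nlinarith
    linarith
  have h4 : (4 : ℝ≥0∞) = ENNReal.ofReal 4 := by simp
  rw [h4, ← ENNReal.ofReal_pow (by norm_num), ← ENNReal.ofReal_pow hq0,
    ← ENNReal.ofReal_mul (by positivity)]
  refine ENNReal.ofReal_le_ofReal ?_
  set m := halfReps δ with hm
  have hlog : 0 ≤ Real.logb 2 (1 / δ) :=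
    Real.logb_nonneg (by norm_num) (by rw [le_div_iff₀ h0]; linarith)
  calc (4 : ℝ) ^ m * (1 - 8 / Real.pi ^ 2) ^ (m + 1) ≤ 4 ^ m * (1 / 5) ^ (m + 1) := by gcongr
    _ = (4 / 5) ^ m * (1 / 5) := by rw [pow_succ, div_pow, div_pow]; ring
    _ ≤ (4 / 5 : ℝ) ^ (m : ℝ) := by
        rw [Real.rpow_natCast]
        exact mul_le_of_le_one_right (by positivity) (by norm_num)
    _ ≤ (4 / 5 : ℝ) ^ (4 * Real.logb 2 (1 / δ)) :=
        Real.rpow_le_rpow_of_exponent_ge (by norm_num) (by norm_num) (Nat.le_ceil _)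
    _ = ((4 / 5 : ℝ) ^ (4 : ℝ)) ^ (Real.logb 2 (1 / δ)) := Real.rpow_mul (by norm_num) _ _
    _ ≤ (2⁻¹ : ℝ) ^ (Real.logb 2 (1 / δ)) := by
        refine Real.rpow_le_rpow (by positivity) ?_ hlog
        norm_num
    _ = δ := by
        rw [Real.inv_rpow (by norm_num), Real.rpow_logb (by norm_num) (by norm_num) (by positivity)]
        simp

lemma prob_basicEst_compl_le (s : Sampler Ω G) (a b : ℝ) (t : ℕ) {δ : ℝ} (h0 : 0 < δ) (h1 : δ ≤ 1)
    (I : Set ℝ) (hI : I.OrdConnected)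
    (h : (amplitudeEstimation (B := Fin 2)
      [Gate.sample (fun _ => true), Gate.free (bernoulliSampler s.toRegisters a b)]
      (PiLp.single 2 0 s.zero) (by rw [PiLp.norm_single, s.norm_zero]) flagReflection t).prob s.S Iᶜ
        ≤ ENNReal.ofReal (1 - 8 / Real.pi ^ 2)) :
    (basicEst s.toRegisters a b t δ).prob s.S Iᶜ ≤ ENNReal.ofReal δ :=
  (Prog.prob_median_le s.S (halfReps δ) _ I hI h).trans (four_pow_halfReps_mul_le h0 h1)

lemma prob_basicEst_error_le (s : Sampler Ω G) (a b : ℝ) {t : ℕ} (ht : 2 ≤ t) {δ : ℝ}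
    (h0 : 0 < δ) (h1 : δ ≤ 1) :
    (basicEst s.toRegisters a b t δ).prob s.S
      {x : ℝ | |x - s.bucketMean a b|
        ≤ 2 * (Real.pi / t) * √(s.bucketMean a b) + (Real.pi / t) ^ 2}ᶜ ≤ ENNReal.ofReal δ := by
  refine prob_basicEst_compl_le s a b t h0 h1 _ ?_ ?_
  · have : {x : ℝ | |x - s.bucketMean a b|
        ≤ 2 * (Real.pi / t) * √(s.bucketMean a b) + (Real.pi / t) ^ 2}
        = Metric.closedBall (s.bucketMean a b)
          (2 * (Real.pi / t) * √(s.bucketMean a b) + (Real.pi / t) ^ 2) := by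
      ext x
      simp [Real.dist_eq]
    rw [this, Real.closedBall_eq_Icc]
    exact Set.ordConnected_Icc
  · have h := prob_amplitudeEstimation_error_le s.S
      [Gate.sample (fun _ => true), Gate.free (bernoulliSampler s.toRegisters a b)]
      (PiLp.single 2 0 s.zero) (by rw [PiLp.norm_single, s.norm_zero]) ht
    rwa [s.norm_bernoulliSampler, Real.sq_sqrt (s.bucketMean_nonneg a b)] at h

lemma prob_basicEst_ne_zero_le (s : Sampler Ω G) (a b : ℝ) {t : ℕ} (ht : 0 < t) {δ : ℝ}
    (h0 : 0 < δ) (h1 : δ ≤ 1) (hsmall : s.bucketMean a b ≤ (1 / (2 * t)) ^ 2) :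
    (basicEst s.toRegisters a b t δ).prob s.S {0}ᶜ ≤ ENNReal.ofReal δ := by
  refine prob_basicEst_compl_le s a b t h0 h1 _ Set.ordConnected_singleton ?_
  refine prob_amplitudeEstimation_ne_zero_le s.S _ _ _ ht ?_
  rw [s.norm_bernoulliSampler]
  exact Real.sqrt_le_iff.2 ⟨by positivity, hsmall⟩

/-- Basic estimation overestimates by at most a constant factor, because it outputs `0` in the
range where its additive error exceeds the estimated quantity. -/
lemma prob_basicEst_gt_le (s : Sampler Ω G) (a b : ℝ) {t : ℕ} (ht : 2 ≤ t) {δ : ℝ}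
    (h0 : 0 < δ) (h1 : δ ≤ 1) :
    (basicEst s.toRegisters a b t δ).prob s.S
      {x : ℝ | x ≤ (1 + 2 * Real.pi) ^ 2 * s.bucketMean a b}ᶜ ≤ ENNReal.ofReal δ := by
  have hp := s.bucketMean_nonneg a b
  have ht' : (0 : ℝ) < t := by exact_mod_cast (by omega : 0 < t)
  have hpi := Real.pi_pos
  rcases le_or_gt (s.bucketMean a b) ((1 / (2 * t)) ^ 2) with h | h
  · refine le_trans (Prog.prob_mono _ _ (Set.compl_subset_compl.2 ?_))
      (prob_basicEst_ne_zero_le s a b (by omega) h0 h1 h)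
    rintro x rfl
    exact mul_nonneg (sq_nonneg _) hp
  · refine le_trans (Prog.prob_mono _ _ (Set.compl_subset_compl.2 ?_))
      (prob_basicEst_error_le s a b ht h0 h1)
    intro x hx
    rw [Set.mem_ofPred_eq] at hx
    have h2 : 1 / (2 * t) ≤ √(s.bucketMean a b) := Real.le_sqrt_of_sq_le h.le
    have h3 : Real.pi / t ≤ 2 * Real.pi * √(s.bucketMean a b) := by
      calc Real.pi / t = 2 * Real.pi * (1 / (2 * t)) := by field_simp
        _ ≤ _ := by gcongr
    have h4 := Real.sq_sqrt hp
    have h5 : 0 ≤ Real.pi / t := by positivity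
    have h6 := (abs_le.1 hx).2
    change x ≤ _
    set r := √(s.bucketMean a b)
    have hr : 0 ≤ r := Real.sqrt_nonneg _
    have h7 : (Real.pi / t) ^ 2 ≤ (2 * Real.pi * r) ^ 2 := pow_le_pow_left₀ h5 h3 2
    have h8 : 2 * (Real.pi / t) * r ≤ 2 * (2 * Real.pi * r) * r := by gcongr
    rw [← h4] at h6 ⊢
    nlinarith

end BasicEstimation

/-! ### Truncated moments and bucketing -/

section Moments

variable {Ω : Finset ℝ} {G : Type u} [NormedAddCommGroup G] [InnerProductSpace ℂ G]

/-- The truncated moment `E[X ^ r; a ≤ X < b]`. -/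
noncomputable def Sampler.truncMoment (s : Sampler Ω G) (r : ℕ) (a b : ℝ) : ℝ :=
  ∑ x, s.d x * (if a ≤ (x : ℝ) ∧ (x : ℝ) < b then (x : ℝ) ^ r else 0)

lemma Sampler.mul_bucketMean (s : Sampler Ω G) (a : ℝ) {b : ℝ} (hb : 0 < b) :
    b * s.bucketMean a b = s.truncMoment 1 a b := by
  rw [Sampler.bucketMean, Sampler.truncMoment, Finset.mul_sum]
  refine Finset.sum_congr rfl fun x _ => ?_
  rw [bernoulliParam]
  split_ifs
  · field_simp
  · simp

lemma Sampler.truncMoment_nonneg (s : Sampler Ω G) (r : ℕ) (a b : ℝ) :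
    0 ≤ s.truncMoment r a b := by
  refine Finset.sum_nonneg fun x _ => mul_nonneg (s.d_nonneg x) ?_
  have := s.nonneg x x.2
  split_ifs <;> positivity

lemma Sampler.truncMoment_one_le_mean (s : Sampler Ω G) (a b : ℝ) :
    s.truncMoment 1 a b ≤ s.mean := by
  refine Finset.sum_le_sum fun x _ => mul_le_mul_of_nonneg_left ?_ (s.d_nonneg x)
  have := s.nonneg x x.2
  split_ifs
  · rw [pow_one]
  · exact this

lemma Sampler.mean_nonneg (s : Sampler Ω G) : 0 ≤ s.mean :=
  Finset.sum_nonneg fun x _ => mul_nonneg (s.d_nonneg x) (s.nonneg x x.2)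

lemma Sampler.rms_sq (s : Sampler Ω G) : s.rms ^ 2 = ∑ x, s.d x * (x : ℝ) ^ 2 :=
  Real.sq_sqrt (Finset.sum_nonneg fun x _ => mul_nonneg (s.d_nonneg x) (sq_nonneg _))

lemma Sampler.rms_nonneg (s : Sampler Ω G) : 0 ≤ s.rms := Real.sqrt_nonneg _

lemma Sampler.truncMoment_two_le (s : Sampler Ω G) (a b : ℝ) :
    s.truncMoment 2 a b ≤ s.rms ^ 2 := by
  rw [s.rms_sq]
  refine Finset.sum_le_sum fun x _ => mul_le_mul_of_nonneg_left ?_ (s.d_nonneg x)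
  split_ifs
  · exact le_rfl
  · positivity

/-- The tail of the mean, bounded by the second moment. -/
lemma Sampler.mean_sub_le_truncMoment (s : Sampler Ω G) {b : ℝ} (hb : 0 < b) :
    s.mean - s.rms ^ 2 / b ≤ s.truncMoment 1 0 b := by
  rw [s.rms_sq, Sampler.mean, Sampler.truncMoment, Finset.sum_div, ← Finset.sum_sub_distrib]
  refine Finset.sum_le_sum fun x _ => ?_
  rw [mul_div_assoc, ← mul_sub]
  refine mul_le_mul_of_nonneg_left ?_ (s.d_nonneg x)
  have hx := s.nonneg x x.2
  split_ifs with h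
  · rw [pow_one]
    have : 0 ≤ (x : ℝ) ^ 2 / b := by positivity
    linarith
  · have hxb : b ≤ x := by
      by_contra! hlt
      exact h ⟨hx, hlt⟩
    have : (x : ℝ) ≤ (x : ℝ) ^ 2 / b := by
      rw [le_div_iff₀ hb]
      nlinarith
    linarith

lemma Sampler.truncMoment_add (s : Sampler Ω G) (r : ℕ) {a b c : ℝ} (hab : a ≤ b) (hbc : b ≤ c) :
    s.truncMoment r a b + s.truncMoment r b c = s.truncMoment r a c := by
  rw [Sampler.truncMoment, Sampler.truncMoment, Sampler.truncMoment, ← Finset.sum_add_distrib]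
  refine Finset.sum_congr rfl fun x _ => ?_
  rw [← mul_add]
  congr 1
  by_cases h1 : (x : ℝ) < b
  · have h2 : ¬ b ≤ (x : ℝ) := not_le.2 h1
    have h3 : (x : ℝ) < c := h1.trans_le hbc
    simp [h1, h2, h3]
  · have h2 : a ≤ (x : ℝ) := hab.trans (not_lt.1 h1)
    simp [h1, h2, not_lt.1 h1]

/-- The lower end of the `l`-th bucket. -/
noncomputable def bucketLow (w : ℝ) (l : ℕ) : ℝ := if l = 0 then 0 else 2 ^ (l - 1) * w

lemma Sampler.sum_truncMoment_bucket (s : Sampler Ω G) (r : ℕ) {w : ℝ} (hw : 0 < w) (k : ℕ) :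
    ∑ l ∈ Finset.range (k + 1), s.truncMoment r (bucketLow w l) (2 ^ l * w)
      = s.truncMoment r 0 (2 ^ k * w) := by
  induction k with
  | zero => simp [bucketLow]
  | succ k ih =>
    rw [Finset.sum_range_succ, ih]
    have : bucketLow w (k + 1) = 2 ^ k * w := by simp [bucketLow]
    rw [this]
    refine s.truncMoment_add r (by positivity) ?_
    gcongr
    · norm_num
    · omega

/-- Within a bucket of ratio `2`, the width of the bucket times the truncated mean is at most twice
the truncated second moment. -/
lemma Sampler.sum_mul_truncMoment_bucket_le (s : Sampler Ω G) {w : ℝ} (hw : 0 < w) (k : ℕ) :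
    ∑ l ∈ Finset.range (k + 1), 2 ^ l * w * s.truncMoment 1 (bucketLow w l) (2 ^ l * w)
      ≤ w * s.mean + 2 * s.rms ^ 2 := by
  have hterm : ∀ l ∈ Finset.range (k + 1),
      2 ^ l * w * s.truncMoment 1 (bucketLow w l) (2 ^ l * w)
        ≤ (if l = 0 then w * s.mean else 0) + 2 * s.truncMoment 2 (bucketLow w l) (2 ^ l * w) := by
    intro l _
    rcases Nat.eq_zero_or_pos l with rfl | hl
    · have h1 := s.truncMoment_one_le_mean (bucketLow w 0) (2 ^ 0 * w)
      have h2 := s.truncMoment_nonneg 2 (bucketLow w 0) (2 ^ 0 * w)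
      rw [if_pos rfl]
      have : 2 ^ 0 * w * s.truncMoment 1 (bucketLow w 0) (2 ^ 0 * w) ≤ 2 ^ 0 * w * s.mean := by
        gcongr
      linarith
    · obtain ⟨m, rfl⟩ : ∃ m, l = m + 1 := ⟨l - 1, by omega⟩
      rw [if_neg (by omega), zero_add, Sampler.truncMoment, Sampler.truncMoment, Finset.mul_sum,
        Finset.mul_sum]
      refine Finset.sum_le_sum fun x _ => ?_
      have hx := s.nonneg x x.2
      have hlow : bucketLow w (m + 1) = 2 ^ m * w := by simp [bucketLow]
      rw [mul_left_comm, mul_left_comm 2]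
      refine mul_le_mul_of_nonneg_left ?_ (s.d_nonneg x)
      split_ifs with h
      · have h1 := h.1
        rw [hlow] at h1
        rw [pow_succ, pow_one]
        nlinarith
      · simp
  refine (Finset.sum_le_sum hterm).trans ?_
  rw [Finset.sum_add_distrib, ← Finset.mul_sum, s.sum_truncMoment_bucket 2 hw k,
    Finset.sum_ite_eq' , if_pos (by simp)]
  linarith [s.truncMoment_two_le 0 (2 ^ k * w)]

/-- The error of the bucketing estimate of the mean, given the errors `2 τ √p + τ ^ 2` of the
estimates of the buckets. -/
lemma Sampler.abs_sum_bucket_sub_mean_le (s : Sampler Ω G) {w : ℝ} (hw : 0 < w) (k : ℕ) {τ : ℝ}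
    (hτ : 0 ≤ τ) (ps : ℕ → ℝ)
    (h : ∀ l ∈ Finset.range (k + 1), |ps l - s.bucketMean (bucketLow w l) (2 ^ l * w)|
      ≤ 2 * τ * √(s.bucketMean (bucketLow w l) (2 ^ l * w)) + τ ^ 2) :
    |∑ l ∈ Finset.range (k + 1), 2 ^ l * w * ps l - s.mean|
      ≤ 2 * τ * √((k + 1) * (w * s.mean + 2 * s.rms ^ 2)) + τ ^ 2 * (2 ^ (k + 1) * w)
        + s.rms ^ 2 / (2 ^ k * w) := by
  set p : ℕ → ℝ := fun l => s.bucketMean (bucketLow w l) (2 ^ l * w) with hp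
  have hsum : ∑ l ∈ Finset.range (k + 1), 2 ^ l * w * p l = s.truncMoment 1 0 (2 ^ k * w) := by
    rw [← s.sum_truncMoment_bucket 1 hw k]
    exact Finset.sum_congr rfl fun l _ => s.mul_bucketMean _ (by positivity)
  have htail : |s.truncMoment 1 0 (2 ^ k * w) - s.mean| ≤ s.rms ^ 2 / (2 ^ k * w) := by
    rw [abs_le]
    have h1 := s.mean_sub_le_truncMoment (b := 2 ^ k * w) (by positivity)
    have h2 := s.truncMoment_one_le_mean 0 (2 ^ k * w)
    have h3 : 0 ≤ s.rms ^ 2 / (2 ^ k * w) := by positivity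
    constructor <;> linarith
  -- the Cauchy-Schwarz inequality over the buckets
  have hcs : ∑ l ∈ Finset.range (k + 1), 2 ^ l * w * √(p l)
      ≤ √((k + 1) * (w * s.mean + 2 * s.rms ^ 2)) := by
    refine Real.le_sqrt_of_sq_le ?_
    refine (sq_sum_le_card_mul_sum_sq).trans ?_
    rw [Finset.card_range]
    push_cast
    refine mul_le_mul_of_nonneg_left ?_ (by positivity)
    refine le_trans (le_of_eq (Finset.sum_congr rfl fun l _ => ?_))
      (s.sum_mul_truncMoment_bucket_le hw k)
    rw [← s.mul_bucketMean _ (by positivity), mul_pow, Real.sq_sqrt (s.bucketMean_nonneg _ _)]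
    ring
  have hgeom : ∑ l ∈ Finset.range (k + 1), 2 ^ l * w ≤ 2 ^ (k + 1) * w := by
    rw [← Finset.sum_mul]
    refine mul_le_mul_of_nonneg_right ?_ hw.le
    have := geom_sum_eq (x := (2 : ℝ)) (by norm_num) (k + 1)
    rw [this]
    norm_num
  have herr : |∑ l ∈ Finset.range (k + 1), 2 ^ l * w * ps l
      - ∑ l ∈ Finset.range (k + 1), 2 ^ l * w * p l|
      ≤ 2 * τ * √((k + 1) * (w * s.mean + 2 * s.rms ^ 2)) + τ ^ 2 * (2 ^ (k + 1) * w) := by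
    rw [← Finset.sum_sub_distrib]
    refine (Finset.abs_sum_le_sum_abs _ _).trans ?_
    calc ∑ l ∈ Finset.range (k + 1), |2 ^ l * w * ps l - 2 ^ l * w * p l|
        ≤ ∑ l ∈ Finset.range (k + 1), (2 * τ * (2 ^ l * w * √(p l)) + τ ^ 2 * (2 ^ l * w)) := by
          refine Finset.sum_le_sum fun l hl => ?_
          rw [← mul_sub, abs_mul, abs_of_pos (by positivity : (0 : ℝ) < 2 ^ l * w)]
          calc 2 ^ l * w * |ps l - p l| ≤ 2 ^ l * w * (2 * τ * √(p l) + τ ^ 2) := by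
                gcongr
                exact h l hl
            _ = _ := by ring
      _ = 2 * τ * ∑ l ∈ Finset.range (k + 1), 2 ^ l * w * √(p l)
          + τ ^ 2 * ∑ l ∈ Finset.range (k + 1), 2 ^ l * w := by
          rw [Finset.sum_add_distrib, Finset.mul_sum, Finset.mul_sum]
      _ ≤ _ := by gcongr
  rw [hsum] at herr
  calc |∑ l ∈ Finset.range (k + 1), 2 ^ l * w * ps l - s.mean|
      ≤ _ + |s.truncMoment 1 0 (2 ^ k * w) - s.mean| := abs_sub_le _ _ _
    _ ≤ _ := by gcongr

end Moments

/-! ### The bucketing subroutine -/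

section BucketingAlgorithm

open ENNReal

variable {Ω : Finset ℝ} {G : Type u} [NormedAddCommGroup G] [InnerProductSpace ℂ G]

lemma prob_sApprox_le (s : Sampler Ω G) (w t δ : ℝ) (k t₀ : ℕ)
    (hk : k = ⌈Real.logb 2 t⌉₊ - 1)
    (ht₀ : t₀ = ⌈3 * Real.pi ^ 2 * t * Real.sqrt (Real.logb 2 t)⌉₊) (good : ℕ → Set ℝ)
    (h : ∀ l, (basicEst s.toRegisters (bucketLow w l) (2 ^ l * w) t₀ (δ / (k + 1))).prob s.S
      (good l)ᶜ ≤ ENNReal.ofReal (δ / (k + 1))) (B : Set ℝ)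
    (hB : ∀ ps : ℕ → ℝ, (∀ l ∈ Finset.range (k + 1), ps l ∈ good l) →
      ∑ l ∈ Finset.range (k + 1), 2 ^ l * w * ps l ∉ B) :
    (sApprox s.toRegisters w t δ).prob s.S B ≤ ENNReal.ofReal δ := by
  subst hk ht₀
  set k := ⌈Real.logb 2 t⌉₊ - 1
  rw [sApprox]
  rw [Prog.prob_bind_pure]
  refine le_trans (Prog.prob_mono _ _ (t := {ps | ∃ i : Fin (k + 1), ps i ∈ (good (i : ℕ))ᶜ}) ?_)
    ((Prog.prob_collect_exists_le s.S (k + 1) _ (fun i : Fin (k + 1) => (good (i : ℕ))ᶜ)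
      fun i => h i).trans_eq ?_)
  · intro ps hps
    by_contra hcon
    simp only [Set.mem_ofPred_eq, Set.mem_compl_iff, not_exists, not_not] at hcon
    refine hB (fun l => if hl : l < k + 1 then ps ⟨l, hl⟩ else 0) (fun l hl => ?_) ?_
    · rw [dif_pos (Finset.mem_range.1 hl)]
      exact hcon ⟨l, Finset.mem_range.1 hl⟩
    · rw [← Fin.sum_univ_eq_sum_range (fun l => 2 ^ l * w *
        (if hl : l < k + 1 then ps ⟨l, hl⟩ else 0))]
      have e : ∑ l : Fin (k + 1), 2 ^ (l : ℕ) * w *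
          (if hl : (l : ℕ) < k + 1 then ps ⟨l, hl⟩ else 0)
          = ∑ l : Fin (k + 1), 2 ^ (l : ℕ) * w * ps l :=
        Finset.sum_congr rfl fun l _ => by rw [dif_pos l.2]
      rw [e]
      exact hps
  · rw [← ENNReal.ofReal_natCast, ← ENNReal.ofReal_mul (by positivity)]
    congr 1
    push_cast
    field_simp

lemma two_le_ceil_of_sApprox {t : ℝ} (ht : 2 ≤ t) :
    2 ≤ ⌈3 * Real.pi ^ 2 * t * Real.sqrt (Real.logb 2 t)⌉₊ := by
  have hl : 1 ≤ Real.logb 2 t := by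
    rw [Real.le_logb_iff_rpow_le (by norm_num) (by linarith)]
    simpa using ht
  have hs : 1 ≤ √(Real.logb 2 t) := Real.one_le_sqrt.2 hl
  have hpi := Real.pi_gt_three
  have : (2 : ℝ) ≤ 3 * Real.pi ^ 2 * t * Real.sqrt (Real.logb 2 t) := by
    calc (2 : ℝ) ≤ 3 * 3 ^ 2 * 2 * 1 := by norm_num
      _ ≤ _ := by gcongr
  exact_mod_cast this.trans (Nat.le_ceil _)

/-- The bucketing subroutine overestimates the mean by at most a constant factor, whatever the
width parameter is. -/
lemma prob_sApprox_gt_le (s : Sampler Ω G) {w t δ : ℝ} (hw : 0 < w) (ht : 2 ≤ t) (h0 : 0 < δ)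
    (h1 : δ ≤ 1) :
    (sApprox s.toRegisters w t δ).prob s.S
      {x : ℝ | x ≤ (1 + 2 * Real.pi) ^ 2 * s.mean}ᶜ ≤ ENNReal.ofReal δ := by
  refine prob_sApprox_le s w t δ _ _ rfl rfl
    (fun l => {x : ℝ | x ≤ (1 + 2 * Real.pi) ^ 2 * s.bucketMean (bucketLow w l) (2 ^ l * w)})
    (fun l => prob_basicEst_gt_le s _ _ (two_le_ceil_of_sApprox ht) (by positivity) ?_) _ ?_
  · rw [div_le_one (by positivity)]
    have : (0 : ℝ) ≤ ((⌈Real.logb 2 t⌉₊ - 1 : ℕ) : ℝ) := Nat.cast_nonneg _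
    linarith
  · intro ps hps
    set k := ⌈Real.logb 2 t⌉₊ - 1
    simp only [Set.mem_compl_iff, Set.mem_ofPred_eq, not_not] at hps ⊢
    calc ∑ l ∈ Finset.range (k + 1), 2 ^ l * w * ps l
        ≤ ∑ l ∈ Finset.range (k + 1), (1 + 2 * Real.pi) ^ 2 *
            s.truncMoment 1 (bucketLow w l) (2 ^ l * w) := by
          refine Finset.sum_le_sum fun l hl => ?_
          rw [← s.mul_bucketMean _ (by positivity), mul_left_comm]
          have := hps l hl
          gcongr
      _ = (1 + 2 * Real.pi) ^ 2 * s.truncMoment 1 0 (2 ^ k * w) := by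
          rw [← Finset.mul_sum, s.sum_truncMoment_bucket 1 hw]
      _ ≤ _ := by
          gcongr
          exact s.truncMoment_one_le_mean _ _

/-- The total error of the bucketing subroutine is at most `ε μ` for the parameters used by the
algorithm. -/
lemma bucketing_error_le {μ φ Δ M ε τ ℓ t t₀ : ℝ} {k : ℕ} (hμ : 0 < μ) (hφ0 : 0 ≤ φ)
    (hφ : φ ≤ Δ * μ)
    (hΔ : 1 ≤ Δ) (hM0 : 2 * μ ≤ M) (hM1 : M ≤ 2500 * μ) (hε : 0 < ε)
    (ht : t = 51 ^ 2 * ε⁻¹ * Δ) (hℓ : 1 ≤ ℓ) (hk : (k : ℝ) + 1 ≤ 2 * ℓ)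
    (hk0 : (2 : ℝ) ^ k ≤ t) (hk1 : t ≤ 2 ^ (k + 1)) (ht₀ : 3 * Real.pi ^ 2 * t * √ℓ ≤ t₀)
    (hτ : τ = Real.pi / t₀) :
    2 * τ * √((k + 1) * (M * Δ * μ + 2 * φ ^ 2)) + τ ^ 2 * (2 ^ (k + 1) * (M * Δ))
        + φ ^ 2 / (2 ^ k * (M * Δ)) ≤ ε * μ := by
  have hpi := Real.pi_gt_three
  have htpos : 0 < t := by rw [ht]; positivity
  have hM : 0 < M := by linarith
  have hsl : 1 ≤ √ℓ := Real.one_le_sqrt.2 hℓ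
  have hτ0 : 0 ≤ τ := by
    rw [hτ]
    refine div_nonneg Real.pi_pos.le (le_trans ?_ ht₀)
    positivity
  have hτ1 : τ ≤ 1 / (9 * t * √ℓ) := by
    rw [hτ]
    calc Real.pi / t₀ ≤ Real.pi / (3 * Real.pi ^ 2 * t * √ℓ) := by gcongr
      _ = 1 / (3 * Real.pi * t * √ℓ) := by field_simp
      _ ≤ 1 / (9 * t * √ℓ) := by
        gcongr
        linarith
  have hΔt : Δ * μ = ε * μ * t / 2601 := by rw [ht]; field_simp; norm_num
  have hφ2 : φ ^ 2 ≤ (Δ * μ) ^ 2 := pow_le_pow_left₀ hφ0 hφ 2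
  -- `71 ^ 2 = 5041` exceeds `2 * (2500 + 2)`
  have hsq : √((k + 1) * (M * Δ * μ + 2 * φ ^ 2)) ≤ 71 * (√ℓ * (Δ * μ)) := by
    refine Real.sqrt_le_iff.2 ⟨by positivity, ?_⟩
    have e : (71 * (√ℓ * (Δ * μ))) ^ 2 = 5041 * (ℓ * (Δ * μ) ^ 2) := by
      rw [mul_pow, mul_pow, Real.sq_sqrt (by linarith)]; ring
    have h1 : M * Δ * μ ≤ 2500 * (Δ * μ) ^ 2 := by
      calc M * Δ * μ ≤ 2500 * μ * Δ * μ := by gcongr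
        _ = 2500 * μ ^ 2 * (Δ * 1) := by ring
        _ ≤ 2500 * μ ^ 2 * (Δ * Δ) := by gcongr
        _ = _ := by ring
    rw [e]
    calc ((k : ℝ) + 1) * (M * Δ * μ + 2 * φ ^ 2)
        ≤ (2 * ℓ) * (2500 * (Δ * μ) ^ 2 + 2 * (Δ * μ) ^ 2) := by gcongr
      _ ≤ _ := by nlinarith [mul_nonneg (by linarith : 0 ≤ ℓ) (sq_nonneg (Δ * μ))]
  have t1 : 2 * τ * √((k + 1) * (M * Δ * μ + 2 * φ ^ 2)) ≤ ε * μ / 10 := by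
    calc 2 * τ * √((k + 1) * (M * Δ * μ + 2 * φ ^ 2))
        ≤ 2 * (1 / (9 * t * √ℓ)) * (71 * (√ℓ * (Δ * μ))) := by gcongr
      _ = 142 / (9 * 2601) * (ε * μ) := by
        rw [hΔt]
        field_simp
        norm_num
      _ ≤ _ := by nlinarith [mul_pos hε hμ]
  have t2 : τ ^ 2 * (2 ^ (k + 1) * (M * Δ)) ≤ ε * μ / 10 := by
    calc τ ^ 2 * (2 ^ (k + 1) * (M * Δ))
        ≤ (1 / (9 * t * √ℓ)) ^ 2 * (2 * t * (2500 * μ * Δ)) := by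
          have : (2 : ℝ) ^ (k + 1) ≤ 2 * t := by rw [pow_succ]; linarith
          gcongr
      _ ≤ (1 / (9 * t * 1)) ^ 2 * (2 * t * (2500 * μ * Δ)) := by gcongr
      _ = 5000 / 81 * (Δ * μ) / t := by field_simp; norm_num
      _ = 5000 / (81 * 2601) * (ε * μ) := by
        rw [hΔt]
        field_simp
      _ ≤ _ := by nlinarith [mul_pos hε hμ]
  have t3 : φ ^ 2 / (2 ^ k * (M * Δ)) ≤ ε * μ / 10 := by
    have hk2 : t / 2 ≤ 2 ^ k := by rw [pow_succ] at hk1; linarith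
    calc φ ^ 2 / (2 ^ k * (M * Δ)) ≤ (Δ * μ) ^ 2 / (t / 2 * (2 * μ * Δ)) := by gcongr
      _ = (Δ * μ) / t := by field_simp
      _ = 1 / 2601 * (ε * μ) := by
        rw [hΔt]
        field_simp
      _ ≤ _ := by nlinarith [mul_pos hε hμ]
  linarith [mul_pos hε hμ]

lemma two_le_sApprox_parameter {Δ : ℕ} {ε : ℝ} (hΔ : 1 ≤ Δ) (hε0 : 0 < ε) (hε1 : ε < 1 / 2) :
    2 ≤ 51 ^ 2 * ε⁻¹ * (Δ : ℝ) := by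
  have hΔ' : (1 : ℝ) ≤ Δ := by exact_mod_cast hΔ
  have hεi : 2 ≤ ε⁻¹ := by
    rw [le_inv_comm₀ (by norm_num) hε0]
    linarith
  calc (2 : ℝ) ≤ 51 ^ 2 * 2 * 1 := by norm_num
    _ ≤ _ := by gcongr

/-- The bucketing subroutine is accurate when its width parameter is `M Δ` with
`2 μ ≤ M ≤ 2500 μ`. -/
lemma prob_sApprox_error_le (s : Sampler Ω G) {Δ : ℕ} {M ε δ : ℝ} (hμ : 0 < s.mean)
    (hφ : s.rms ≤ Δ * s.mean) (hΔ : 1 ≤ Δ) (hM0 : 2 * s.mean ≤ M) (hM1 : M ≤ 2500 * s.mean)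
    (hε : 0 < ε) (hε1 : ε < 1 / 2) (h0 : 0 < δ) (h1 : δ ≤ 1) :
    (sApprox s.toRegisters (M * Δ) (51 ^ 2 * ε⁻¹ * Δ) δ).prob s.S
      {x : ℝ | |x - s.mean| ≤ ε * s.mean}ᶜ ≤ ENNReal.ofReal δ := by
  have hΔ' : (1 : ℝ) ≤ Δ := by exact_mod_cast hΔ
  have hM : 0 < M := by linarith
  have hw : 0 < M * Δ := by positivity
  set t : ℝ := 51 ^ 2 * ε⁻¹ * Δ with htdef
  have ht : 2 ≤ t := two_le_sApprox_parameter hΔ hε hε1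
  have hl : 1 ≤ Real.logb 2 t := by
    rw [Real.le_logb_iff_rpow_le (by norm_num) (by linarith)]
    simpa using ht
  have htl : (2 : ℝ) ^ Real.logb 2 t = t :=
    Real.rpow_logb (by norm_num) (by norm_num) (by linarith)
  have hceil : 1 ≤ ⌈Real.logb 2 t⌉₊ := Nat.one_le_ceil_iff.2 (by linarith)
  obtain ⟨k, hk⟩ : ∃ k, ⌈Real.logb 2 t⌉₊ = k + 1 := ⟨⌈Real.logb 2 t⌉₊ - 1, by omega⟩
  have hk' : k = ⌈Real.logb 2 t⌉₊ - 1 := by omega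
  have hlt : (k : ℝ) + 1 < Real.logb 2 t + 1 := by
    have := Nat.ceil_lt_add_one (by linarith : 0 ≤ Real.logb 2 t)
    rw [hk] at this
    exact_mod_cast this
  have hle : Real.logb 2 t ≤ ((k + 1 : ℕ) : ℝ) := hk ▸ Nat.le_ceil _
  have hk0 : (2 : ℝ) ^ k ≤ t := by
    rw [← htl, ← Real.rpow_natCast]
    exact Real.rpow_le_rpow_of_exponent_le (by norm_num) (by linarith)
  have hk1 : t ≤ 2 ^ (k + 1) := by
    rw [← htl, ← Real.rpow_natCast 2 (k + 1)]
    exact Real.rpow_le_rpow_of_exponent_le (by norm_num) hle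
  set t₀ : ℕ := ⌈3 * Real.pi ^ 2 * t * Real.sqrt (Real.logb 2 t)⌉₊ with ht₀
  refine prob_sApprox_le s (M * Δ) t δ k t₀ hk' ht₀
    (fun l => {x : ℝ | |x - s.bucketMean (bucketLow (M * Δ) l) (2 ^ l * (M * Δ))|
        ≤ 2 * (Real.pi / t₀) * √(s.bucketMean (bucketLow (M * Δ) l) (2 ^ l * (M * Δ)))
          + (Real.pi / t₀) ^ 2})
    (fun l => prob_basicEst_error_le s _ _ (two_le_ceil_of_sApprox ht) (by positivity) ?_) _ ?_
  · rw [div_le_one (by positivity)]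
    have : (0 : ℝ) ≤ (k : ℝ) := Nat.cast_nonneg _
    linarith
  · intro ps hps
    simp only [Set.mem_compl_iff, Set.mem_ofPred_eq, not_not] at hps ⊢
    have hpi := Real.pi_pos
    refine (s.abs_sum_bucket_sub_mean_le hw k (τ := Real.pi / t₀) (by positivity) ps hps).trans ?_
    exact bucketing_error_le hμ s.rms_nonneg hφ hΔ' hM0 hM1 hε htdef hl (by linarith) hk0 hk1
      (Nat.le_ceil _) rfl

end BucketingAlgorithm

/-! ### The search for the order of magnitude of the mean -/

section Search

open ENNReal

variable {Ω : Finset ℝ} {G : Type u} [NormedAddCommGroup G] [InnerProductSpace ℂ G]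

lemma searchLoop_of_ne_zero (R : Registers Ω G) (Δ : ℕ) (L : ℝ) (hL : 0 < L) (δ' M : ℝ) {p : ℝ}
    (hp : p ≠ 0) : searchLoop R Δ L hL δ' M p = pure M := by
  rw [searchLoop, dif_neg fun h => hp h.1]

lemma searchLoop_of_lt (R : Registers Ω G) (Δ : ℕ) {L : ℝ} (hL : 0 < L) (δ' : ℝ) {M : ℝ} (p : ℝ)
    (hM : M < 2 * L) : searchLoop R Δ L hL δ' M p = pure M := by
  rw [searchLoop, dif_neg fun h => absurd h.2 (not_le.2 hM)]

lemma searchLoop_of_le (R : Registers Ω G) (Δ : ℕ) {L : ℝ} (hL : 0 < L) (δ' : ℝ) {M : ℝ}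
    (hM : 2 * L ≤ M) :
    searchLoop R Δ L hL δ' M 0 =
      basicEst R 0 (M / 2 * (Δ : ℝ) ^ 2) (25 * Δ) δ' >>= fun p' =>
        searchLoop R Δ L hL δ' (M / 2) p' := by
  rw [searchLoop, dif_pos ⟨rfl, hM⟩]

/-- For a range much larger than the mean, basic estimation outputs `0`. -/
lemma prob_search_ne_zero_le (s : Sampler Ω G) {Δ : ℕ} (hΔ : 1 ≤ Δ) {M δ : ℝ} (h0 : 0 < δ)
    (h1 : δ ≤ 1) (hM0 : 0 < M) (hM : 2500 * s.mean ≤ M) :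
    (basicEst s.toRegisters 0 (M * (Δ : ℝ) ^ 2) (25 * Δ) δ).prob s.S {0}ᶜ ≤ ENNReal.ofReal δ := by
  have hΔ' : (0 : ℝ) < Δ := by exact_mod_cast hΔ
  refine prob_basicEst_ne_zero_le s _ _ (by omega) h0 h1 ?_
  have hb := s.mul_bucketMean 0 (b := M * (Δ : ℝ) ^ 2) (by positivity)
  have h2 := s.truncMoment_one_le_mean 0 (M * (Δ : ℝ) ^ 2)
  set p := s.bucketMean 0 (M * (Δ : ℝ) ^ 2)
  have e : (1 / (2 * ((25 * Δ : ℕ) : ℝ))) ^ 2 = 1 / (2500 * (Δ : ℝ) ^ 2) := by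
    push_cast
    field_simp
    norm_num
  rw [e, le_div_iff₀ (by positivity)]
  have h3 : M * (p * (2500 * (Δ : ℝ) ^ 2)) ≤ M * 1 := by
    calc M * (p * (2500 * (Δ : ℝ) ^ 2)) = 2500 * (M * (Δ : ℝ) ^ 2 * p) := by ring
      _ ≤ 2500 * s.mean := by rw [hb]; gcongr
      _ ≤ M * 1 := by linarith
  exact le_of_mul_le_mul_left h3 hM0

/-- For a range close to `μ Δ ^ 2`, basic estimation outputs a nonzero value. -/
lemma prob_search_eq_zero_le (s : Sampler Ω G) {Δ : ℕ} (hΔ : 1 ≤ Δ) {M δ : ℝ} (h0 : 0 < δ)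
    (h1 : δ ≤ 1) (hμ : 0 < s.mean) (hφ : s.rms ≤ Δ * s.mean) (hM0 : 2 * s.mean ≤ M)
    (hM1 : M ≤ 4 * s.mean) :
    (basicEst s.toRegisters 0 (M * (Δ : ℝ) ^ 2) (25 * Δ) δ).prob s.S {0} ≤ ENNReal.ofReal δ := by
  have hΔ' : (0 : ℝ) < Δ := by exact_mod_cast hΔ
  have hM : 0 < M := by linarith
  have hb0 : 0 < M * (Δ : ℝ) ^ 2 := by positivity
  refine le_trans (Prog.prob_mono _ _ ?_) (prob_basicEst_error_le s _ _ (by omega) h0 h1)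
  rintro x rfl
  have hb := s.mul_bucketMean 0 hb0
  have htail := s.mean_sub_le_truncMoment hb0
  set μ := s.mean
  set p := s.bucketMean 0 (M * (Δ : ℝ) ^ 2)
  have hp0 : 0 ≤ p := s.bucketMean_nonneg _ _
  have hphi : s.rms ^ 2 / (M * (Δ : ℝ) ^ 2) ≤ μ / 2 := by
    rw [div_le_iff₀ hb0]
    calc s.rms ^ 2 ≤ (Δ * μ) ^ 2 := pow_le_pow_left₀ s.rms_nonneg hφ 2
      _ = μ / 2 * (2 * μ * (Δ : ℝ) ^ 2) := by ring
      _ ≤ μ / 2 * (M * (Δ : ℝ) ^ 2) := by gcongr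
  -- the estimated quantity is at least `1 / (8 Δ ^ 2)`
  have hp : 1 ≤ 8 * (Δ * √p) ^ 2 := by
    rw [mul_pow, Real.sq_sqrt hp0]
    have h2 : μ / 2 ≤ 4 * μ * (Δ : ℝ) ^ 2 * p := by
      calc μ / 2 ≤ M * (Δ : ℝ) ^ 2 * p := by rw [hb]; linarith
        _ ≤ _ := by gcongr
    have h3 : μ * 1 ≤ μ * (8 * ((Δ : ℝ) ^ 2 * p)) := by linarith
    exact le_of_mul_le_mul_left h3 hμ
  intro hcon
  rw [Set.mem_ofPred_eq, zero_sub, abs_neg, abs_of_nonneg hp0] at hcon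
  have hpi := Real.pi_lt_d2
  have hpi0 := Real.pi_pos
  have ht : Real.pi / ((25 * Δ : ℕ) : ℝ) = Real.pi / 25 / Δ := by
    push_cast
    field_simp
  have hsp : p = √p ^ 2 := (Real.sq_sqrt hp0).symm
  rw [ht] at hcon
  set z := Δ * √p with hz
  have hz0 : 0 ≤ z := by positivity
  have e : √p = z / Δ := by rw [hz]; field_simp
  rw [hsp, e, Real.sqrt_sq (by positivity)] at hcon
  have h5 : z ^ 2 ≤ 2 * (Real.pi / 25) * z + (Real.pi / 25) ^ 2 := by
    have e2 : 2 * (Real.pi / 25 / Δ) * (z / Δ) + (Real.pi / 25 / Δ) ^ 2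
        = (2 * (Real.pi / 25) * z + (Real.pi / 25) ^ 2) / (Δ : ℝ) ^ 2 := by field_simp
    rw [e2, div_pow, div_le_div_iff_of_pos_right (by positivity)] at hcon
    exact hcon
  -- `z ≥ 1 / √8 > 0.35`, while the inequality `h5` forces `z ≤ (1 + √2) π / 25 < 0.31`
  have h6 : Real.pi / 25 ≤ 0.126 := by linarith
  have h7 : (Real.pi / 25) ^ 2 ≤ 0.126 ^ 2 := pow_le_pow_left₀ (by positivity) h6 2
  have h8 : 0.35 ≤ z := by nlinarith
  nlinarith

/-- Except with probability `δ'` per iteration, the search stops with `2 μ ≤ M < 2500 μ`. -/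
lemma prob_searchLoop_le (s : Sampler Ω G) {Δ : ℕ} (hΔ : 1 ≤ Δ) {L : ℝ} (hL : 0 < L) {δ' : ℝ}
    (h0 : 0 < δ') (h1 : δ' ≤ 1) (hμ : L < s.mean) (hφ : s.rms ≤ Δ * s.mean) (n : ℕ) :
    ∀ M : ℝ, 4 * s.mean ≤ M → M < 2 ^ (n + 1) * L →
      (searchLoop s.toRegisters Δ L hL δ' M 0).prob s.S
        {M' : ℝ | 2 * s.mean ≤ M' ∧ M' ≤ 2500 * s.mean}ᶜ ≤ n * ENNReal.ofReal δ' := by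
  have hμ0 : 0 < s.mean := hL.trans hμ
  induction n with
  | zero =>
    intro M hM hM1
    exfalso
    norm_num at hM1
    linarith
  | succ n ih =>
    intro M hM hM1
    rw [searchLoop_of_le _ _ _ _ (by linarith)]
    have hM2 : M / 2 < 2 ^ (n + 1) * L := by
      rw [pow_succ] at hM1
      linarith
    push_cast
    rw [add_comm, add_mul, one_mul]
    have hreturn : ∀ x : ℝ, x ≠ 0 → M / 2 ≤ 2500 * s.mean →
        (searchLoop s.toRegisters Δ L hL δ' (M / 2) x).prob s.S
          {M' : ℝ | 2 * s.mean ≤ M' ∧ M' ≤ 2500 * s.mean}ᶜ ≤ n * ENNReal.ofReal δ' := by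
      intro x hx hM3
      rw [searchLoop_of_ne_zero _ _ _ _ _ _ hx, Prog.prob_pure_of_notMem]
      · exact zero_le
      · exact fun h => h ⟨by linarith, hM3⟩
    -- only one outcome is bad: a nonzero one while `M / 2 ≥ 2500 μ`, and `0` once `M / 2 < 4 μ`
    rcases le_or_gt (2500 * s.mean) (M / 2) with hM3 | hM3
    · refine Prog.prob_bind_le _ _ _ {0}ᶜ _
        (prob_search_ne_zero_le s hΔ h0 h1 (by linarith) hM3) fun x hx => ?_
      rw [Set.mem_compl_iff, not_not] at hx
      rw [Set.mem_singleton_iff.1 hx]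
      exact ih (M / 2) (by linarith) hM2
    rcases le_or_gt (4 * s.mean) (M / 2) with hM4 | hM4
    · refine Prog.prob_bind_le _ _ _ ∅ _ (by simp [Prog.prob]) fun x _ => ?_
      by_cases hx : x = 0
      · rw [hx]
        exact ih (M / 2) hM4 hM2
      · exact hreturn x hx hM3.le
    · refine Prog.prob_bind_le _ _ _ {0} _
        (prob_search_eq_zero_le s hΔ h0 h1 hμ0 hφ (by linarith) hM4.le) fun x hx => ?_
      exact hreturn x hx hM3.le

/-- The number of iterations of the search. -/
lemma exists_numIterations {L H : ℝ} (hL : 0 < L) (hH : L < H) :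
    ∃ n : ℕ, 8 * H < 2 ^ (n + 1) * L ∧ (n : ℝ) ≤ 3 + Real.logb 2 (H / L) := by
  have hHL : 1 < H / L := (one_lt_div hL).2 hH
  have hlog : 0 < Real.logb 2 (H / L) := Real.logb_pos (by norm_num) hHL
  refine ⟨⌊3 + Real.logb 2 (H / L)⌋₊, ?_, Nat.floor_le (by linarith)⟩
  have h1 := Nat.lt_floor_add_one (3 + Real.logb 2 (H / L))
  have h2 : (2 : ℝ) ^ (3 + Real.logb 2 (H / L))
      < 2 ^ ((⌊3 + Real.logb 2 (H / L)⌋₊ + 1 : ℕ) : ℝ) :=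
    Real.rpow_lt_rpow_of_exponent_lt (by norm_num) (by exact_mod_cast h1)
  rw [Real.rpow_natCast, Real.rpow_add (by norm_num),
    Real.rpow_logb (by norm_num) (by norm_num) (by positivity)] at h2
  calc 8 * H = (2 : ℝ) ^ (3 : ℝ) * (H / L) * L := by
        have : (2 : ℝ) ^ (3 : ℝ) = 8 := by norm_num
        rw [this]
        field_simp
    _ < _ := by gcongr

end Search

/-! ### Correctness of the algorithm -/

section Correctness

open ENNReal

variable {Ω : Finset ℝ} {G : Type u} [NormedAddCommGroup G] [InnerProductSpace ℂ G]

lemma one_sub_le_law_toMeasure_real {H : Type u} [NormedAddCommGroup H] [InnerProductSpace ℂ H]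
    (S : H ≃ₗᵢ[ℂ] H) (p : Prog H ℝ) {δ : ℝ} (h0 : 0 ≤ δ) {s : Set ℝ} (hs : MeasurableSet s)
    (h : p.prob S sᶜ ≤ ENNReal.ofReal δ) : 1 - δ ≤ (p.law S).toMeasure.real s := by
  have h1 := MeasureTheory.probReal_compl_eq_one_sub (μ := (p.law S).toMeasure) hs
  have h2 : (p.law S).toMeasure.real sᶜ ≤ δ := by
    rw [MeasureTheory.measureReal_def, PMF.toMeasure_apply_eq_toOuterMeasure_apply _ hs.compl]
    exact ENNReal.toReal_le_of_le_ofReal h0 h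
  linarith

lemma searchLoop_error_pos {L H δ : ℝ} (hL : 0 < L) (hH : L < H) (h0 : 0 < δ) (h1 : δ < 1 / 2) :
    0 < Real.logb 2 (H / L) ∧ 0 < δ / (2 * (3 + Real.logb 2 (H / L)))
      ∧ δ / (2 * (3 + Real.logb 2 (H / L))) ≤ 1 := by
  have hlog : 0 < Real.logb 2 (H / L) := Real.logb_pos (by norm_num) ((one_lt_div hL).2 hH)
  refine ⟨hlog, by positivity, ?_⟩
  rw [div_le_one (by positivity)]
  linarith

lemma prob_epsApprox_error_le (s : Sampler Ω G) {Δ : ℕ} {L H ε δ : ℝ} (hL : 0 < L) (hΔ : 1 ≤ Δ)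
    (hLH : L < H) (hε0 : 0 < ε) (hε1 : ε < 1 / 2) (hδ0 : 0 < δ) (hδ1 : δ < 1 / 2)
    (hφ : s.rms / s.mean ≤ Δ) (hμL : L < s.mean) (hμH : s.mean < H) :
    (epsApprox s.toRegisters Δ L hL H ε δ).prob s.S {x : ℝ | |x - s.mean| ≤ ε * s.mean}ᶜ
      ≤ ENNReal.ofReal δ := by
  have hμ : 0 < s.mean := hL.trans hμL
  have hφ' : s.rms ≤ Δ * s.mean := (div_le_iff₀ hμ).1 hφ
  obtain ⟨hlog, hδ', hδ'1⟩ := searchLoop_error_pos hL hLH hδ0 hδ1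
  obtain ⟨n, hn, hn1⟩ := exists_numIterations hL hLH
  rw [epsApprox]
  refine (Prog.prob_bind_le s.S _ _ {M' : ℝ | 2 * s.mean ≤ M' ∧ M' ≤ 2500 * s.mean}ᶜ _
    (prob_searchLoop_le s hΔ hL hδ' hδ'1 hμL hφ' n (8 * H) (by linarith) hn)
    (b := ENNReal.ofReal (δ / 2)) fun M hM => ?_).trans ?_
  · rw [Set.mem_compl_iff, not_not] at hM
    rw [if_neg (by linarith [hM.1])]
    exact prob_sApprox_error_le s hμ hφ' hΔ hM.1 hM.2 hε0 hε1 (by linarith) (by linarith)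
  · rw [← ENNReal.ofReal_natCast, ← ENNReal.ofReal_mul (by positivity),
      ← ENNReal.ofReal_add (by positivity) (by positivity)]
    refine ENNReal.ofReal_le_ofReal ?_
    have : n * (δ / (2 * (3 + Real.logb 2 (H / L)))) ≤ δ / 2 := by
      calc n * (δ / (2 * (3 + Real.logb 2 (H / L))))
          ≤ (3 + Real.logb 2 (H / L)) * (δ / (2 * (3 + Real.logb 2 (H / L)))) := by gcongr
        _ = δ / 2 := by field_simp
    linarith

lemma prob_epsApprox_gt_le (s : Sampler Ω G) {Δ : ℕ} {L H ε δ : ℝ} (hL : 0 < L) (hΔ : 1 ≤ Δ)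
    (hε0 : 0 < ε) (hε1 : ε < 1 / 2) (hδ0 : 0 < δ) (hδ1 : δ < 1 / 2) :
    (epsApprox s.toRegisters Δ L hL H ε δ).prob s.S
      {x : ℝ | x ≤ (1 + 2 * Real.pi) ^ 2 * s.mean}ᶜ ≤ ENNReal.ofReal δ := by
  have hΔ' : (0 : ℝ) < Δ := by exact_mod_cast hΔ
  rw [epsApprox]
  refine (Prog.prob_bind_le s.S _ _ ∅ _ (a := 0) (b := ENNReal.ofReal (δ / 2))
    (by simp [Prog.prob]) fun M _ => ?_).trans ?_
  · split_ifs with h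
    · rw [Prog.prob_pure_of_notMem]
      · exact zero_le
      · exact fun h => h (mul_nonneg (sq_nonneg _) s.mean_nonneg)
    · have hM : 0 < M := by linarith
      exact prob_sApprox_gt_le s (by positivity) (two_le_sApprox_parameter hΔ hε0 hε1)
        (by linarith) (by linarith)
  · rw [zero_add]
    exact ENNReal.ofReal_le_ofReal (by linarith)

end Correctness

/-! ### The number of quantum samples -/

section Samples

variable {A B T : Type} [Fintype A] [Fintype B] [Fintype T] {α β : Type}
variable {K : Type u} [NormedAddCommGroup K] [InnerProductSpace ℂ K]

lemma Circuit.samples_append (c c' : Circuit A K) :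
    Circuit.samples (c ++ c' : List (Gate A K)) = c.samples + c'.samples := by
  simp [Circuit.samples]

lemma Circuit.samples_control (P : T → Bool) (c : Circuit B K) :
    (c.control P).samples = c.samples := by
  simp only [Circuit.samples, Circuit.control, List.map_map]
  congr 2
  funext g
  cases g <;> rfl

lemma Circuit.samples_inv (c : Circuit B K) : c.inv.samples = c.samples := by
  simp only [Circuit.samples, Circuit.inv, List.map_reverse, List.sum_reverse, List.map_map]
  congr 2
  funext g
  cases g <;> rfl

lemma samples_groverIterate (U : Circuit B K) (v : Reg B K) (W : Reg B K ≃ₗᵢ[ℂ] Reg B K) :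
    (groverIterate U v W).samples = 2 * U.samples := by
  simp only [groverIterate, Circuit.samples_append, Circuit.samples_inv]
  simp [Circuit.samples, Gate.samples]
  ring

lemma samples_amplitudeCircuit_le (U : Circuit B K) (v : Reg B K)
    (W : Reg B K ≃ₗᵢ[ℂ] Reg B K) {t : ℕ} (ht : 0 < t) :
    (amplitudeCircuit U v W t).samples ≤ 2 * t * U.samples := by
  have hpow : ∀ n : ℕ, Circuit.samples ((List.range n).flatMap
      (fun i => (groverIterate U v W).control (T := Fin t) fun j => decide (i < (j : ℕ))))
      = n * (2 * U.samples) := by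
    intro n
    induction n with
    | zero => simp [Circuit.samples]
    | succ n ih =>
      rw [List.range_succ, List.flatMap_append, Circuit.samples_append, ih,
        List.flatMap_singleton, Circuit.samples_control, samples_groverIterate]
      ring
  have hfree : ∀ V : Reg (Fin t) (Reg B K) ≃ₗᵢ[ℂ] Reg (Fin t) (Reg B K),
      Circuit.samples ([onFirst V] : List (Gate (Fin t × B) K)) = 0 := by
    intro V
    simp [Circuit.samples, Gate.samples, onFirst]
  obtain ⟨t, rfl⟩ : ∃ m, t = m + 1 := ⟨t - 1, by omega⟩
  simp only [amplitudeCircuit, Circuit.samples_append, hfree, hpow, Circuit.samples_control,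
    Nat.add_sub_cancel]
  nlinarith [Nat.zero_le U.samples]

lemma samples_amplitudeEstimation_le (U : Circuit B K) (v : Reg B K) (hv : ‖v‖ = 1)
    (W : Reg B K ≃ₗᵢ[ℂ] Reg B K) (t : ℕ) :
    (amplitudeEstimation U v hv W t).samples ≤ 2 * t * U.samples := by
  rw [amplitudeEstimation]
  split_ifs with ht
  · have h : (Finset.univ.sup fun i : Fin t × B =>
        (pure (Real.sin (Real.pi * (i.1 : ℕ) / t) ^ 2) : Prog K ℝ).samples) ≤ 0 :=
      Finset.sup_le fun _ _ => le_rfl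
    exact (add_le_add (samples_amplitudeCircuit_le U v W ht) h).trans_eq (add_zero _)
  · exact Nat.zero_le _

lemma Prog.samples_bind_le (p : Prog K α) (f : α → Prog K β) {b : ℕ}
    (h : ∀ x, (f x).samples ≤ b) : (p >>= f).samples ≤ p.samples + b := by
  induction p with
  | ret x => exact (h x).trans (Nat.le_add_left _ _)
  | run A init hi c next ih =>
    change c.samples + Finset.univ.sup (fun a => ((next a) >>= f).samples)
      ≤ c.samples + Finset.univ.sup (fun a => (next a).samples) + b
    have : Finset.univ.sup (fun a => ((next a) >>= f).samples)
        ≤ Finset.univ.sup (fun a => (next a).samples) + b :=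
      Finset.sup_le fun a ha => (ih a).trans
        (Nat.add_le_add_right (Finset.le_sup (f := fun a => (next a).samples) ha) b)
    omega

lemma Prog.samples_bind_pure_le (p : Prog K α) (f : α → β) :
    (p >>= fun x => pure (f x)).samples ≤ p.samples :=
  Prog.samples_bind_le p _ (b := 0) fun _ => le_rfl

lemma Prog.samples_collect_le (n : ℕ) (p : Fin n → Prog K α) {c : ℕ}
    (h : ∀ i, (p i).samples ≤ c) : (Prog.collect n p).samples ≤ n * c := by
  induction n with
  | zero => exact Nat.zero_le _
  | succ n ih =>
    rw [Prog.collect_succ]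
    refine (Prog.samples_bind_le _ _ (b := n * c) fun x => ?_).trans ?_
    · exact (Prog.samples_bind_pure_le _ _).trans (ih _ fun i => h i.succ)
    · have := h 0
      rw [add_mul, one_mul]
      omega

variable {Ω : Finset ℝ} {G : Type u} [NormedAddCommGroup G] [InnerProductSpace ℂ G]

lemma samples_basicEst_le (R : Registers Ω G) (a b : ℝ) (t : ℕ) (δ : ℝ) :
    (basicEst R a b t δ).samples ≤ (2 * halfReps δ + 1) * (2 * t) := by
  rw [basicEst]
  refine (Prog.samples_bind_pure_le _ _).trans (Prog.samples_collect_le _ _ fun _ => ?_)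
  refine (samples_amplitudeEstimation_le _ _ _ _ _).trans_eq ?_
  simp [Circuit.samples, Gate.samples]

lemma samples_sApprox_le (R : Registers Ω G) (w t δ : ℝ) :
    (sApprox R w t δ).samples ≤ (⌈Real.logb 2 t⌉₊ - 1 + 1) *
      ((2 * halfReps (δ / ((⌈Real.logb 2 t⌉₊ - 1 : ℕ) + 1)) + 1) *
        (2 * ⌈3 * Real.pi ^ 2 * t * Real.sqrt (Real.logb 2 t)⌉₊)) := by
  rw [sApprox]
  exact (Prog.samples_bind_pure_le _ _).trans
    (Prog.samples_collect_le _ _ fun _ => samples_basicEst_le _ _ _ _ _)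

lemma samples_searchLoop_le (R : Registers Ω G) (Δ : ℕ) {L : ℝ} (hL : 0 < L) (δ' : ℝ) (n : ℕ) :
    ∀ M p : ℝ, M < 2 ^ (n + 1) * L →
      (searchLoop R Δ L hL δ' M p).samples ≤ n * ((2 * halfReps δ' + 1) * (2 * (25 * Δ))) := by
  induction n with
  | zero =>
    intro M p hM
    rw [zero_add, pow_one] at hM
    rw [searchLoop_of_lt R Δ hL δ' p hM]
    exact Nat.zero_le _
  | succ n ih =>
    intro M p hM
    rw [searchLoop]
    split_ifs with h
    · refine (Prog.samples_bind_le _ _ fun p' => ih (M / 2) p' ?_).trans ?_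
      · rw [pow_succ] at hM
        linarith
      · have := samples_basicEst_le R 0 (M / 2 * (Δ : ℝ) ^ 2) (25 * Δ) δ'
        rw [add_mul n 1, one_mul]
        omega
    · exact Nat.zero_le _

lemma samples_epsApprox_le (R : Registers Ω G) (Δ : ℕ) {L H ε δ : ℝ} (hL : 0 < L) {n : ℕ}
    (hn : 8 * H < 2 ^ (n + 1) * L) {b : ℕ}
    (hb : ∀ w, (sApprox R w (51 ^ 2 * ε⁻¹ * Δ) (δ / 2)).samples ≤ b) :
    (epsApprox R Δ L hL H ε δ).samples
      ≤ n * ((2 * halfReps (δ / (2 * (3 + Real.logb 2 (H / L)))) + 1) * (2 * (25 * Δ))) + b := by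
  rw [epsApprox]
  refine (Prog.samples_bind_le _ _ (b := b) fun M => ?_).trans
    (Nat.add_le_add_right (samples_searchLoop_le R Δ hL _ n _ _ hn) b)
  split_ifs
  · exact Nat.zero_le _
  · exact hb _

/-- The number of repetitions in the basic estimation algorithm is `O(log (1 / δ))`. -/
lemma two_mul_halfReps_add_one_le {δ y c : ℝ} (hy : 1 ≤ y) (hδ1 : 1 ≤ 1 / δ)
    (h : 1 / δ ≤ 2 ^ c * 2 ^ y) (hc : 0 ≤ c) :
    ((2 * halfReps δ + 1 : ℕ) : ℝ) ≤ (8 * c + 11) * y := by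
  have hlog0 : 0 ≤ Real.logb 2 (1 / δ) := Real.logb_nonneg (by norm_num) hδ1
  have hlog : Real.logb 2 (1 / δ) ≤ c + y := by
    rw [Real.logb_le_iff_le_rpow (by norm_num) (by linarith), Real.rpow_add (by norm_num)]
    exact h
  have hm : (halfReps δ : ℝ) < 4 * Real.logb 2 (1 / δ) + 1 := Nat.ceil_lt_add_one (by positivity)
  push_cast
  nlinarith

/-- The number of quantum samples used by the search. -/
lemma search_cost_le {Δ : ℕ} {L H δ : ℝ} (hL : 0 < L) (hLH : L < H) (hδ0 : 0 < δ)
    (hδ1 : δ < 1 / 2) {n : ℕ} (hn : (n : ℝ) ≤ 3 + Real.logb 2 (H / L)) :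
    ((n * ((2 * halfReps (δ / (2 * (3 + Real.logb 2 (H / L)))) + 1) * (2 * (25 * Δ))) : ℕ) : ℝ)
      ≤ 6000 * (Δ * (Real.logb 2 (2 * H / L) * Real.logb 2 (Real.logb 2 (2 * H / L) / δ))) := by
  have hHL : 1 < H / L := (one_lt_div hL).2 hLH
  have hlog : 0 < Real.logb 2 (H / L) := Real.logb_pos (by norm_num) hHL
  have e : Real.logb 2 (2 * H / L) = 1 + Real.logb 2 (H / L) := by
    rw [mul_div_assoc, Real.logb_mul (by norm_num) (by positivity),
      Real.logb_self_eq_one (by norm_num)]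
  set a := Real.logb 2 (2 * H / L) with ha
  have ha1 : 1 ≤ a := by linarith
  have hb1 : 1 ≤ Real.logb 2 (a / δ) := by
    rw [Real.le_logb_iff_rpow_le (by norm_num) (by positivity), Real.rpow_one, le_div_iff₀ hδ0]
    linarith
  have hreps := two_mul_halfReps_add_one_le (c := 3) hb1
    (δ := δ / (2 * (3 + Real.logb 2 (H / L)))) (by
      rw [one_div_div, le_div_iff₀ hδ0]
      linarith) (by
      rw [one_div_div, Real.rpow_logb (by norm_num) (by norm_num) (by positivity),
        div_le_iff₀ hδ0, mul_assoc, div_mul_cancel₀ _ hδ0.ne']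
      norm_num
      linarith) (by norm_num)
  set r := Real.logb 2 (a / δ)
  have hn' : (n : ℝ) ≤ 3 * a := by linarith
  push_cast at hreps ⊢
  calc _ ≤ 3 * a * ((8 * 3 + 11) * r * (2 * (25 * (Δ : ℝ)))) := by gcongr
    _ = 5250 * (Δ * (a * r)) := by ring
    _ ≤ 6000 * (Δ * (a * r)) := by
      gcongr
      norm_num

/-- The number of quantum samples used by the bucketing subroutine. -/
lemma bucketing_cost_le {Δ : ℕ} {ε δ : ℝ} (hΔ : 1 ≤ Δ) (hε0 : 0 < ε) (hε1 : ε < 1 / 2)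
    (hδ0 : 0 < δ) (hδ1 : δ < 1 / 2) :
    ((((⌈Real.logb 2 (51 ^ 2 * ε⁻¹ * Δ)⌉₊ - 1 + 1) *
      ((2 * halfReps (δ / 2 / ((⌈Real.logb 2 (51 ^ 2 * ε⁻¹ * Δ)⌉₊ - 1 : ℕ) + 1)) + 1) *
        (2 * ⌈3 * Real.pi ^ 2 * (51 ^ 2 * ε⁻¹ * Δ) *
          Real.sqrt (Real.logb 2 (51 ^ 2 * ε⁻¹ * Δ))⌉₊)) : ℕ)) : ℝ)
      ≤ 600000000 * (Δ * (ε⁻¹ * Real.logb 2 (Δ / ε) ^ (3 / 2 : ℝ)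
              * Real.logb 2 (Real.logb 2 (Δ / ε) / δ))) := by
  have hΔ' : (1 : ℝ) ≤ Δ := by exact_mod_cast hΔ
  have ht := two_le_sApprox_parameter hΔ hε0 hε1
  set t : ℝ := 51 ^ 2 * ε⁻¹ * Δ with htdef
  have htd : t = 2601 * (Δ / ε) := by rw [htdef]; field_simp; norm_num
  have hDε : 2 < Δ / ε := by
    rw [lt_div_iff₀ hε0]
    linarith
  set D := Real.logb 2 (Δ / ε) with hD
  have hD1 : 1 ≤ D := by
    rw [hD, Real.le_logb_iff_rpow_le (by norm_num) (by positivity), Real.rpow_one]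
    exact hDε.le
  have hE1 : 1 ≤ Real.logb 2 (D / δ) := by
    rw [Real.le_logb_iff_rpow_le (by norm_num) (by positivity), Real.rpow_one, le_div_iff₀ hδ0]
    linarith
  have hl1 : 1 ≤ Real.logb 2 t := by
    rw [Real.le_logb_iff_rpow_le (by norm_num) (by linarith), Real.rpow_one]
    exact ht
  have hl : Real.logb 2 t ≤ 13 * D := by
    -- `51 ^ 2 ≤ 2 ^ 12`
    have h1 : Real.logb 2 t ≤ 12 + D := by
      rw [Real.logb_le_iff_le_rpow (by norm_num) (by linarith), Real.rpow_add (by norm_num), hD,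
        Real.rpow_logb (by norm_num) (by norm_num) (by positivity), htd]
      gcongr
      norm_num
    linarith
  set ℓ := Real.logb 2 t
  have hceil : 1 ≤ ⌈ℓ⌉₊ := Nat.one_le_ceil_iff.2 (by linarith)
  obtain ⟨k, hk⟩ : ∃ k, ⌈ℓ⌉₊ = k + 1 := ⟨⌈ℓ⌉₊ - 1, by omega⟩
  have hkl : (k : ℝ) + 1 ≤ 14 * D := by
    have := Nat.ceil_lt_add_one (by linarith : 0 ≤ ℓ)
    rw [hk] at this
    push_cast at this
    linarith
  rw [hk, Nat.add_sub_cancel]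
  have hk0 : (0 : ℝ) ≤ k := Nat.cast_nonneg k
  have hreps := two_mul_halfReps_add_one_le (c := 5) hE1 (δ := δ / 2 / ((k : ℝ) + 1)) (by
      rw [div_div, one_div_div, le_div_iff₀ hδ0]
      linarith) (by
      rw [div_div, one_div_div, Real.rpow_logb (by norm_num) (by norm_num) (by positivity),
        div_le_iff₀ hδ0, mul_assoc, div_mul_cancel₀ _ hδ0.ne']
      norm_num
      linarith) (by norm_num)
  set r := Real.logb 2 (D / δ)
  have hpi := Real.pi_gt_three
  have hpi2 := Real.pi_lt_d2
  have hsl : 1 ≤ √ℓ := Real.one_le_sqrt.2 hl1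
  have hsD : √ℓ ≤ 4 * √D := by
    refine Real.sqrt_le_iff.2 ⟨by positivity, ?_⟩
    rw [mul_pow, Real.sq_sqrt (by linarith)]
    linarith
  have ht₀ : (⌈3 * Real.pi ^ 2 * t * √ℓ⌉₊ : ℝ) ≤ 416160 * (Δ / ε) * √D := by
    have h1 := Nat.ceil_lt_add_one (by positivity : 0 ≤ 3 * Real.pi ^ 2 * t * √ℓ)
    have h2 : 1 ≤ t * √ℓ := by nlinarith
    have h3 : Real.pi ^ 2 ≤ 10 := by nlinarith
    have hp : 0 ≤ t * √ℓ := by positivity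
    calc (⌈3 * Real.pi ^ 2 * t * √ℓ⌉₊ : ℝ) ≤ 3 * Real.pi ^ 2 * (t * √ℓ) + 1 := by linarith
      _ ≤ 3 * 10 * (t * √ℓ) + t * √ℓ := by gcongr
      _ ≤ 40 * (t * √ℓ) := by linarith
      _ ≤ 40 * (t * (4 * √D)) := by gcongr
      _ = _ := by rw [htd]; ring
  have hpow : D ^ (3 / 2 : ℝ) = D * √D := by
    rw [Real.sqrt_eq_rpow, ← Real.rpow_one_add' (by linarith) (by norm_num)]
    norm_num
  have hr : (0 : ℝ) ≤ r := by linarith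
  push_cast at hreps ⊢
  rw [hpow]
  calc _ ≤ 14 * D * ((8 * 5 + 11) * r * (2 * (416160 * (Δ / ε) * √D))) := by gcongr
    _ = 594276480 * (Δ * (ε⁻¹ * (D * √D) * r)) := by ring
    _ ≤ _ := by
      gcongr
      norm_num

lemma samples_epsApprox_bound (R : Registers Ω G) {Δ : ℕ} {L H ε δ : ℝ} (hL : 0 < L)
    (hΔ : 1 ≤ Δ) (hLH : L < H) (hε0 : 0 < ε) (hε1 : ε < 1 / 2) (hδ0 : 0 < δ) (hδ1 : δ < 1 / 2) :
    ((epsApprox R Δ L hL H ε δ).samples : ℝ) ≤ 600000000 *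
      (Δ * (Real.logb 2 (2 * H / L) * Real.logb 2 (Real.logb 2 (2 * H / L) / δ)
            + ε⁻¹ * Real.logb 2 (Δ / ε) ^ (3 / 2 : ℝ)
              * Real.logb 2 (Real.logb 2 (Δ / ε) / δ))) := by
  obtain ⟨n, hn, hn1⟩ := exists_numIterations hL hLH
  have h := samples_epsApprox_le R Δ (ε := ε) (δ := δ) hL hn
    (fun w => samples_sApprox_le R w (51 ^ 2 * ε⁻¹ * Δ) (δ / 2))
  have h1 := search_cost_le (Δ := Δ) hL hLH hδ0 hδ1 hn1
  have h2 := bucketing_cost_le hΔ hε0 hε1 hδ0 hδ1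
  have h3 : (0 : ℝ) ≤ ((n * ((2 * halfReps (δ / (2 * (3 + Real.logb 2 (H / L)))) + 1) *
    (2 * (25 * Δ))) : ℕ) : ℝ) := Nat.cast_nonneg _
  have h4 : ((epsApprox R Δ L hL H ε δ).samples : ℝ) ≤ _ := Nat.cast_le.2 h
  rw [Nat.cast_add] at h4
  rw [mul_add (Δ : ℝ), mul_add]
  refine h4.trans (add_le_add (h1.trans ?_) h2)
  have h5 := h3.trans h1
  linarith

/-- The form of the bound when `1 / ε` is at most polynomial in `Δ`. -/
lemma cost_bound_of_inv_le_rpow {Δ : ℕ} {c L H ε δ : ℝ} (hc : 0 < c) (hL : 0 < L) (hΔ : 2 ≤ Δ)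
    (hLH : 2 * L ≤ H) (hε0 : 0 < ε) (hδ0 : 0 < δ) (hδ1 : δ < 1 / 2)
    (hεΔ : ε⁻¹ ≤ (Δ : ℝ) ^ c) (hεΔ2 : 2 ≤ Δ / ε) :
    Real.logb 2 (2 * H / L) * Real.logb 2 (Real.logb 2 (2 * H / L) / δ)
            + ε⁻¹ * Real.logb 2 (Δ / ε) ^ (3 / 2 : ℝ)
              * Real.logb 2 (Real.logb 2 (Δ / ε) / δ)
      ≤ (4 + (1 + c) ^ (3 / 2 : ℝ) * (1 + Real.logb 2 (1 + c))) *
        (Real.logb 2 (H / L) * Real.logb 2 (Real.logb 2 (H / L) / δ)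
            + ε⁻¹ * Real.logb 2 Δ ^ (3 / 2 : ℝ) * Real.logb 2 (Real.logb 2 Δ / δ)) := by
  have hΔ' : (2 : ℝ) ≤ Δ := by exact_mod_cast hΔ
  have hHL : 2 ≤ H / L := by rwa [le_div_iff₀ hL]
  have hone : ∀ x : ℝ, 2 ≤ x → 1 ≤ Real.logb 2 x := by
    intro x hx
    rw [Real.le_logb_iff_rpow_le (by norm_num) (by linarith), Real.rpow_one]
    exact hx
  have hratio : ∀ x : ℝ, 1 ≤ x → 1 ≤ Real.logb 2 (x / δ) := by
    intro x hx
    refine hone _ ?_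
    rw [le_div_iff₀ hδ0]
    linarith
  -- replacing `x ≤ q y` by `y` changes `log (x / δ)` by a constant factor
  have hchange : ∀ x y q : ℝ, 1 ≤ x → 1 ≤ y → 1 ≤ q → x ≤ q * y →
      Real.logb 2 (x / δ) ≤ (1 + Real.logb 2 q) * Real.logb 2 (y / δ) := by
    intro x y q hx hy hq hxy
    have h1 := hratio y hy
    have h2 : 0 ≤ Real.logb 2 q := Real.logb_nonneg (by norm_num) hq
    calc Real.logb 2 (x / δ) ≤ Real.logb 2 (q * (y / δ)) := by
          refine Real.logb_le_logb_of_le (by norm_num) (by positivity) ?_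
          rw [← mul_div_assoc]
          gcongr
      _ = Real.logb 2 q + Real.logb 2 (y / δ) := Real.logb_mul (by positivity) (by positivity)
      _ ≤ _ := by nlinarith
  have e : Real.logb 2 (2 * H / L) = 1 + Real.logb 2 (H / L) := by
    rw [mul_div_assoc, Real.logb_mul (by norm_num) (by positivity),
      Real.logb_self_eq_one (by norm_num)]
  set A := Real.logb 2 (H / L)
  have hA : 1 ≤ A := hone _ hHL
  set D := Real.logb 2 (Δ : ℝ) with hDdef
  have hD : 1 ≤ D := hone _ hΔ'
  have hD2 : 1 ≤ Real.logb 2 (Δ / ε) := hone _ hεΔ2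
  have hDle : Real.logb 2 (Δ / ε) ≤ (1 + c) * D := by
    calc Real.logb 2 (Δ / ε) ≤ Real.logb 2 ((Δ : ℝ) ^ (1 + c)) := by
          refine Real.logb_le_logb_of_le (by norm_num) (by positivity) ?_
          rw [Real.rpow_add (by positivity), Real.rpow_one, div_eq_mul_inv]
          gcongr
      _ = (1 + c) * D := Real.logb_rpow_eq_mul_logb_of_pos (by positivity)
  rw [e]
  have h1 := hchange (1 + A) A 2 (by linarith) hA (by norm_num) (by linarith)
  rw [Real.logb_self_eq_one (by norm_num)] at h1
  have h2 := hchange (Real.logb 2 (Δ / ε)) D (1 + c) hD2 hD (by linarith) hDle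
  have hrA := hratio A hA
  have hrD := hratio D hD
  have hq : 0 ≤ Real.logb 2 (1 + c) := Real.logb_nonneg (by norm_num) (by linarith)
  have hlogpos := hratio (1 + A) (by linarith)
  have hlogpos2 := hratio _ hD2
  set X := A * Real.logb 2 (A / δ) with hX
  set Y := ε⁻¹ * D ^ (3 / 2 : ℝ) * Real.logb 2 (D / δ) with hY
  have hX0 : 0 ≤ X := by positivity
  have hY0 : 0 ≤ Y := by positivity
  have t1 : (1 + A) * Real.logb 2 ((1 + A) / δ) ≤ 4 * X := by
    calc (1 + A) * Real.logb 2 ((1 + A) / δ) ≤ (2 * A) * ((1 + 1) * Real.logb 2 (A / δ)) := by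
          gcongr
          linarith
      _ = 4 * X := by rw [hX]; ring
  have t2 : ε⁻¹ * Real.logb 2 (Δ / ε) ^ (3 / 2 : ℝ) * Real.logb 2 (Real.logb 2 (Δ / ε) / δ)
      ≤ (1 + c) ^ (3 / 2 : ℝ) * (1 + Real.logb 2 (1 + c)) * Y := by
    calc ε⁻¹ * Real.logb 2 (Δ / ε) ^ (3 / 2 : ℝ) * Real.logb 2 (Real.logb 2 (Δ / ε) / δ)
        ≤ ε⁻¹ * ((1 + c) * D) ^ (3 / 2 : ℝ)
            * ((1 + Real.logb 2 (1 + c)) * Real.logb 2 (D / δ)) := by gcongr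
      _ = _ := by
        rw [Real.mul_rpow (by positivity) (by positivity), hY]
        ring
  have hc0 : 0 ≤ (1 + c) ^ (3 / 2 : ℝ) * (1 + Real.logb 2 (1 + c)) := by positivity
  nlinarith [mul_nonneg hc0 hX0]

end Samples

end QCheb

theorem mainTheorem1 :
    -- correctness, for every sampler and all valid inputs
    (∀ (Ω : Finset ℝ) (G : Type u) [NormedAddCommGroup G] [InnerProductSpace ℂ G]
        (s : QCheb.Sampler Ω G) (Δ : ℕ) (L H ε δ : ℝ) (hL : 0 < L),
        1 ≤ Δ → L < H → 0 < ε → ε < 1 / 2 → 0 < δ → δ < 1 / 2 →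
        (s.rms / s.mean ≤ Δ → L < s.mean → s.mean < H →
          1 - δ ≤ ((QCheb.epsApprox s.toRegisters Δ L hL H ε δ).law s.S).toMeasure.real
            {x : ℝ | |x - s.mean| ≤ ε * s.mean}) ∧
        1 - δ ≤ ((QCheb.epsApprox s.toRegisters Δ L hL H ε δ).law s.S).toMeasure.real
          {x : ℝ | x ≤ (1 + 2 * Real.pi) ^ 2 * s.mean}) ∧
    -- number of quantum samples, for all valid inputs, with an absolute constant
    (∃ C : ℝ, 0 < C ∧
      ∀ (Ω : Finset ℝ) (G : Type u) [NormedAddCommGroup G] [InnerProductSpace ℂ G]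
        (R : QCheb.Registers Ω G) (Δ : ℕ) (L H ε δ : ℝ) (hL : 0 < L),
        1 ≤ Δ → L < H → 0 < ε → ε < 1 / 2 → 0 < δ → δ < 1 / 2 →
        ((QCheb.epsApprox R Δ L hL H ε δ).samples : ℝ) ≤
          C * (Δ * (Real.logb 2 (2 * H / L) * Real.logb 2 (Real.logb 2 (2 * H / L) / δ)
            + ε⁻¹ * Real.logb 2 (Δ / ε) ^ (3 / 2 : ℝ)
              * Real.logb 2 (Real.logb 2 (Δ / ε) / δ)))) ∧
    -- the form of the bound when `1 / ε` is at most polynomial in `Δ`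
    (∀ c : ℝ, 0 < c → ∃ C : ℝ, 0 < C ∧
      ∀ (Ω : Finset ℝ) (G : Type u) [NormedAddCommGroup G] [InnerProductSpace ℂ G]
        (R : QCheb.Registers Ω G) (Δ : ℕ) (L H ε δ : ℝ) (hL : 0 < L),
        2 ≤ Δ → 2 * L ≤ H → 0 < ε → ε < 1 / 2 → 0 < δ → δ < 1 / 2 → ε⁻¹ ≤ (Δ : ℝ) ^ c →
        ((QCheb.epsApprox R Δ L hL H ε δ).samples : ℝ) ≤
          C * (Δ * (Real.logb 2 (H / L) * Real.logb 2 (Real.logb 2 (H / L) / δ)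
            + ε⁻¹ * Real.logb 2 Δ ^ (3 / 2 : ℝ)
              * Real.logb 2 (Real.logb 2 Δ / δ)))) := by
  refine ⟨?_, ⟨600000000, by norm_num, ?_⟩, fun c hc => ?_⟩
  · intro Ω G _ _ s Δ L H ε δ hL hΔ hLH hε0 hε1 hδ0 hδ1
    refine ⟨fun hφ hμL hμH => ?_, ?_⟩
    · refine QCheb.one_sub_le_law_toMeasure_real _ _ hδ0.le ?_
        (QCheb.prob_epsApprox_error_le s hL hΔ hLH hε0 hε1 hδ0 hδ1 hφ hμL hμH)
      exact measurableSet_le (by fun_prop) (by fun_prop)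
    · exact QCheb.one_sub_le_law_toMeasure_real _ _ hδ0.le measurableSet_Iic
        (QCheb.prob_epsApprox_gt_le s hL hΔ hε0 hε1 hδ0 hδ1)
  · intro Ω G _ _ R Δ L H ε δ hL hΔ hLH hε0 hε1 hδ0 hδ1
    exact QCheb.samples_epsApprox_bound R hL hΔ hLH hε0 hε1 hδ0 hδ1
  · have hq : 0 ≤ Real.logb 2 (1 + c) := Real.logb_nonneg (by norm_num) (by linarith)
    refine ⟨600000000 * (4 + (1 + c) ^ (3 / 2 : ℝ) * (1 + Real.logb 2 (1 + c))), by positivity, ?_⟩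
    intro Ω G _ _ R Δ L H ε δ hL hΔ hLH hε0 hε1 hδ0 hδ1 hεΔ
    have hΔε : (2 : ℝ) ≤ Δ / ε := by
      have hΔ' : (2 : ℝ) ≤ Δ := by exact_mod_cast hΔ
      rw [le_div_iff₀ hε0]
      linarith
    refine (QCheb.samples_epsApprox_bound R hL (by omega) (by linarith) hε0 hε1 hδ0 hδ1).trans ?_
    have h := QCheb.cost_bound_of_inv_le_rpow hc hL hΔ hLH hε0 hδ0 hδ1 hεΔ hΔε
    refine (mul_le_mul_of_nonneg_left (mul_le_mul_of_nonneg_left h (Nat.cast_nonneg Δ))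
      (by norm_num)).trans_eq ?_
    ring
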